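/- Fix $\beta_*\in(0,1)$. For $\alpha\in(0,1)$ let $T_\alpha:[0,1]\to[0,1]$ be the Pomeau–Manneville map, $T_\alpha(x)=x(1+2^\alpha x^\alpha)$ for $x\in[0,1/2)$ and $T_\alpha(x)=2x-1$ for $x\in[1/2,1]$. A sequence $(T_{\alpha_n})_{n\ge1}$ is called admissible if $0<\alpha_n\le\beta_*$ for all $n\ge1$; put $\widetilde T_n=T_{\alpha_n}\circ\cdots\circ T_{\alpha_1}$ and $\widetilde T_0=\mathrm{id}$. Let $m$ be Lebesgue measure on $[0,1]$, $m(f)=\int f\,dm$, and let $\mathcal C_*$ be the set of $f\in C((0,1])\cap L^1(m)$ such that $f\ge0$, $f$ is non-increasing, $x^{\beta_*+1}f(x)$ is non-decreasing, and $f(x)\le 2^{\beta_*}(2+\beta_*)x^{-\beta_*}m(f)$ on $(0,1]$. For a Lipschitz function $f:[0,1]\to\mathbb R$ let $\|f\|_{\mathrm{Lip}}=\sup_{[0,1]}|f|+\sup_{x\ne y}\frac{|f(x)-f(y)|}{|x-y|}$; for $f\in L^\infty([0,1])$ let $\|f\|_\infty$ be the essential supremum of $|f|$ with respect to $m$. Let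 $\rho(0)=\rho(1)=1$ and $\rho(n)=n^{1-1/\beta_*}(\log n)^{1/\beta_*}$ for $n\ge2$. There is a constant $C>0$ depending only on $\beta_*$ such that the following holds. Let $(T_{\alpha_n})_{n\ge1}$ be an admissible sequence, $0\le l<k$ and $0=n_0\le n_1\le\cdots\le n_k$ integers, $f_0,\dots,f_l:[0,1]\to\mathbb R$ Lipschitz functions and $f_{l+1},\dots,f_k\in L^\infty([0,1])$, and set $$H=\prod_{i=0}^{l}f_i\circ\widetilde T_{n_i},\qquad G=\prod_{i=l+1}^{k}f_i\circ\widetilde T_{n_i}.$$ Then, for every probability measure $\mu$ on $[0,1]$ with a density (with respect to $m$) $h\in\mathcal C_*$, the functions $H$, $G$ and $HG$ are $\mu$-integrable and $$\left|\int HG\,d\mu-\int H\,d\mu\int G\,d\mu\right|\le C\,\prod_{i=0}^{l}\|f_i\|_{\mathrm{Lip}}\prod_{i=l+1}^{k}\|f_i\|_\infty\;\rho(n_{l+1}-n_l).$$ -/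

import Mathlib

open MeasureTheory

noncomputable section

namespace PomeauManneville

/-- Lebesgue measure `m` on the unit interval `[0,1]`, as a measure on `ℝ`. -/
def leb : Measure ℝ := volume.restrict (Set.Icc (0 : ℝ) 1)

/-- The Pomeau-Manneville (Liverani-Saussol-Vaienti) map `T_a`. It is used only on `[0,1]`,
which it maps into itself; the values outside `[0,1]` play no role. -/
def pmMap (a : ℝ) (x : ℝ) : ℝ :=
  if x < 1 / 2 then x * (1 + (2 : ℝ) ^ a * x ^ a) else 2 * x - 1

/-- A sequence of parameters `α 1, α 2, …` (the value `α 0` is not used) is admissible for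
`β` if `0 < α n ≤ β` for all `n ≥ 1`. -/
def Admissible (β : ℝ) (α : ℕ → ℝ) : Prop :=
  ∀ n : ℕ, 1 ≤ n → 0 < α n ∧ α n ≤ β

/-- The composition `T_{α n} ∘ ⋯ ∘ T_{α 1}`, the identity for `n = 0`. -/
def compMap (α : ℕ → ℝ) : ℕ → ℝ → ℝ
  | 0 => id
  | n + 1 => pmMap (α (n + 1)) ∘ compMap α n

/-- The convex cone `𝒞_*(β)`. Functions are considered on `(0,1]`; "decreasing" and
"increasing" are meant in the weak sense. -/
structure InCone (β : ℝ) (h : ℝ → ℝ) : Prop where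
  continuousOn : ContinuousOn h (Set.Ioc 0 1)
  integrable : Integrable h leb
  nonneg : ∀ x ∈ Set.Ioc (0 : ℝ) 1, 0 ≤ h x
  decreasing : AntitoneOn h (Set.Ioc 0 1)
  increasing : MonotoneOn (fun x : ℝ => x ^ (β + 1) * h x) (Set.Ioc 0 1)
  bound : ∀ x ∈ Set.Ioc (0 : ℝ) 1,
    h x ≤ (2 : ℝ) ^ β * (2 + β) * x ^ (-β) * ∫ y, h y ∂leb

/-- `f` is Lipschitz continuous on `[0,1]`. -/
def IsLip (f : ℝ → ℝ) : Prop := ∃ K : NNReal, LipschitzOnWith K f (Set.Icc 0 1)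

/-- The best Lipschitz constant of `f` on `[0,1]` (for `f` satisfying `IsLip`). -/
def lipConst (f : ℝ → ℝ) : ℝ :=
  sSup {r : ℝ | ∃ x ∈ Set.Icc (0 : ℝ) 1, ∃ y ∈ Set.Icc (0 : ℝ) 1,
    x ≠ y ∧ r = |f x - f y| / |x - y|}

/-- The supremum of `|f|` over `[0,1]` (for `f` bounded on `[0,1]`). -/
def supNorm (f : ℝ → ℝ) : ℝ := ⨆ x : Set.Icc (0 : ℝ) 1, |f x|

/-- `‖f‖_Lip = ‖f‖_∞ + Lip(f)`. -/
def lipNorm (f : ℝ → ℝ) : ℝ := supNorm f + lipConst f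

/-- The norm of `f` in `L^∞([0,1])`, i.e. the Lebesgue-essential supremum of `|f|`. -/
def essNorm (f : ℝ → ℝ) : ℝ := (eLpNorm f ⊤ leb).toReal

/-- The rate function: `ρ(0) = ρ(1) = 1` and `ρ(n) = n^(1 - 1/β) (log n)^(1/β)` for `n ≥ 2`. -/
def rho (β : ℝ) (n : ℕ) : ℝ :=
  if n < 2 then 1 else (n : ℝ) ^ (-(1 / β) + 1) * (Real.log n) ^ (1 / β)

/-- The product of the functions `f i ∘ (T_{α (n i)} ∘ ⋯ ∘ T_{α 1})` over `i ∈ s`. -/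
def prodObs (α : ℕ → ℝ) (n : ℕ → ℕ) (f : ℕ → ℝ → ℝ) (s : Finset ℕ) (x : ℝ) : ℝ :=
  ∏ i ∈ s, f i (compMap α (n i) x)

end PomeauManneville

end

/-!
The estimate is a statement about loss of memory for the transfer operators `P` of the maps. Let `h`
be the density of `μ`, and let `u` and `ψ` be the functions at time `n l` which are obtained by
pushing forward `h` and `H h`. With `c = ∫ H dμ` the left hand side is the integral of
`P ⋯ P (ψ - c u)`, over `n (l + 1) - n l` steps, against a function bounded by the product of the
essential suprema. So an `L¹` bound on `P ⋯ P (ψ - c u)` is needed.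

*Reduction to decreasing densities.* All branches expand, so `H` is Lipschitz along the inverse
branches of the composition, with a norm bounded by the product of the Lipschitz norms. This is
encoded by the relation `Dominated S K u ψ`, which transfer operators preserve and which multiplies
correctly under Lipschitz factors (`exists_dominated_pushforward`). Adding `(S + K (1 - x)) u` makes
`ψ` decreasing; hence `ψ - c u` is a difference of two decreasing densities of equal mass which are
`O(x ^ (-β))` (`Dominated.exists_eq_sub`). Of the cone conditions only monotonicity and the bound
`x ^ (-β)` are used; both survive the transfer operators (`DecDensity.transfer`).

*Lower bounds.* A decreasing density takes its minimum at `1`. Removing this minimum at each step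
removes mass proportional to the value at `1 / 2`, which also controls the mass re-entering a
neighbourhood of `0`. The potential `max x ε ^ (-β)` drops by a fixed amount under the left branch
beyond `ε`, so summing this drift (`exists_removed_mass`) shows that a density of mass `s` has lost
half of it after `O(ε ^ (-β))` steps, where `ε` is chosen with `M ε ^ (1 - β)` of order `s`. The
removed constants stay bounded below in later steps, because the images of the constant density are
uniformly bounded below (`exists_le_transferIter_one`). Hence the image of a density of mass `s` is
at least `γ s` after `O((M / s) ^ (β / (1 - β)))` steps (`exists_le_transferIter`).

*Loss of memory.* Two densities of equal mass `s` therefore share a constant part `γ s`, which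
cancels in their difference, and what remains is again a pair of decreasing densities of equal mass.
Repeating this, the masses decay geometrically while the waiting times grow geometrically, which
gives the rate `n ^ (1 - 1 / β)` (`exists_memory_loss`), slightly better than `rho`.
-/

noncomputable section

namespace PomeauManneville

/-! ### The inverse branches and the transfer operator -/

/-- The left branch of `pmMap`, without the restriction to `x < 1 / 2`. -/
def leftMap (a x : ℝ) : ℝ := x * (1 + (2 : ℝ) ^ a * x ^ a)

/-- The derivative of `leftMap a` at `x > 0`. -/
def slope (a x : ℝ) : ℝ := 1 + (1 + a) * (2 : ℝ) ^ a * x ^ a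

/-- The inverse of the left branch, from `[0,1]` onto `[0,1/2]`; its values outside `[0,1]` are
meaningless. -/
def leftInv (a : ℝ) : ℝ → ℝ := Function.invFunOn (leftMap a) (Set.Icc 0 (1 / 2))

/-- The Perron-Frobenius operator of `pmMap a`, defined pointwise on `(0,1]` by summing over the
two inverse branches. The derivative of the left inverse branch is written as the reciprocal of
`slope`, so that this inverse never has to be differentiated. -/
def transfer (a : ℝ) (f : ℝ → ℝ) (x : ℝ) : ℝ :=
  f (leftInv a x) / slope a (leftInv a x) + f ((x + 1) / 2) / 2

lemma two_rpow_mul_half_rpow (a : ℝ) : (2 : ℝ) ^ a * (1 / 2 : ℝ) ^ a = 1 := by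
  rw [← Real.mul_rpow (by norm_num) (by norm_num)]; norm_num

lemma leftMap_zero (a : ℝ) : leftMap a 0 = 0 := by simp [leftMap]

lemma leftMap_half (a : ℝ) : leftMap a (1 / 2) = 1 := by
  rw [leftMap, two_rpow_mul_half_rpow]; norm_num

lemma slope_half (a : ℝ) : slope a (1 / 2) = 2 + a := by
  rw [slope, mul_assoc, two_rpow_mul_half_rpow]; ring

lemma one_le_slope {a x : ℝ} (ha : 0 < a) (hx : 0 ≤ x) : 1 ≤ slope a x := by
  unfold slope
  have : 0 ≤ (1 + a) * (2 : ℝ) ^ a * x ^ a := by positivity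
  linarith

lemma slope_pos {a x : ℝ} (ha : 0 < a) (hx : 0 ≤ x) : 0 < slope a x :=
  lt_of_lt_of_le one_pos (one_le_slope ha hx)

lemma slope_mono {a x y : ℝ} (ha : 0 < a) (hx : 0 ≤ x) (hxy : x ≤ y) :
    slope a x ≤ slope a y := by
  unfold slope; gcongr

lemma slope_le_three {a x : ℝ} (ha : 0 < a) (ha1 : a ≤ 1) (hx : 0 ≤ x) (hx' : x ≤ 1 / 2) :
    slope a x ≤ 3 := by
  have := slope_mono ha hx hx'
  rw [slope_half] at this; linarith

/-- The left branch is expanding. -/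
lemma sub_le_leftMap_sub {a x y : ℝ} (ha : 0 < a) (hx : 0 ≤ x) (hxy : x ≤ y) :
    y - x ≤ leftMap a y - leftMap a x := by
  have : x * ((2 : ℝ) ^ a * x ^ a) ≤ y * ((2 : ℝ) ^ a * y ^ a) := by
    have : 0 ≤ y := hx.trans hxy
    gcongr
  unfold leftMap; linarith

lemma strictMonoOn_leftMap {a : ℝ} (ha : 0 < a) :
    StrictMonoOn (leftMap a) (Set.Ici 0) := by
  intro x hx y _ hxy
  have := sub_le_leftMap_sub ha hx hxy.le
  linarith

lemma continuous_leftMap {a : ℝ} (ha : 0 < a) : Continuous (leftMap a) := by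
  unfold leftMap
  have := Real.continuous_rpow_const (q := a) ha.le
  fun_prop

lemma hasDerivAt_leftMap (a : ℝ) {x : ℝ} (hx : 0 < x) :
    HasDerivAt (leftMap a) (slope a x) x := by
  have h1 : HasDerivAt (fun x : ℝ => 1 + (2 : ℝ) ^ a * x ^ a)
      ((2 : ℝ) ^ a * (a * x ^ (a - 1))) x :=
    ((Real.hasDerivAt_rpow_const (Or.inl hx.ne')).const_mul _).const_add _
  have h2 := (hasDerivAt_id x).mul h1
  refine h2.congr_deriv ?_
  have h3 : x * x ^ (a - 1) = x ^ a := by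
    rw [Real.rpow_sub_one hx.ne']; field_simp
  simp only [id, slope]
  linear_combination (2 : ℝ) ^ a * a * h3

lemma surjOn_leftMap {a : ℝ} (ha : 0 < a) :
    Set.SurjOn (leftMap a) (Set.Icc 0 (1 / 2)) (Set.Icc 0 1) := by
  have := intermediate_value_Icc (by norm_num : (0 : ℝ) ≤ 1 / 2)
    (continuous_leftMap ha).continuousOn
  rwa [leftMap_zero, leftMap_half] at this

lemma leftInv_mem_Icc {a x : ℝ} (ha : 0 < a) (hx : x ∈ Set.Icc (0 : ℝ) 1) :
    leftInv a x ∈ Set.Icc (0 : ℝ) (1 / 2) :=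
  Function.invFunOn_mem (surjOn_leftMap ha hx)

lemma leftMap_leftInv {a x : ℝ} (ha : 0 < a) (hx : x ∈ Set.Icc (0 : ℝ) 1) :
    leftMap a (leftInv a x) = x :=
  Function.invFunOn_eq (surjOn_leftMap ha hx)

lemma le_leftInv {a x y : ℝ} (ha : 0 < a) (hx : x ∈ Set.Icc (0 : ℝ) 1) (hy : 0 ≤ y)
    (h : leftMap a y ≤ x) : y ≤ leftInv a x := by
  rw [← leftMap_leftInv ha hx] at h
  exact ((strictMonoOn_leftMap ha).le_iff_le hy (leftInv_mem_Icc ha hx).1).1 h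

lemma leftInv_le {a x y : ℝ} (ha : 0 < a) (hx : x ∈ Set.Icc (0 : ℝ) 1) (hy : 0 ≤ y)
    (h : x ≤ leftMap a y) : leftInv a x ≤ y := by
  rw [← leftMap_leftInv ha hx] at h
  exact ((strictMonoOn_leftMap ha).le_iff_le (leftInv_mem_Icc ha hx).1 hy).1 h

lemma leftMap_mem_Icc {a y : ℝ} (ha : 0 < a) (hy : y ∈ Set.Icc (0 : ℝ) (1 / 2)) :
    leftMap a y ∈ Set.Icc (0 : ℝ) 1 := by
  have hm := (strictMonoOn_leftMap ha).monotoneOn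
  constructor
  · rw [← leftMap_zero a]; exact hm Set.self_mem_Ici hy.1 hy.1
  · rw [← leftMap_half a]; exact hm hy.1 (by norm_num : (0 : ℝ) ≤ 1 / 2) hy.2

lemma leftInv_leftMap {a y : ℝ} (ha : 0 < a) (hy : y ∈ Set.Icc (0 : ℝ) (1 / 2)) :
    leftInv a (leftMap a y) = y :=
  le_antisymm (leftInv_le ha (leftMap_mem_Icc ha hy) hy.1 le_rfl)
    (le_leftInv ha (leftMap_mem_Icc ha hy) hy.1 le_rfl)

lemma leftInv_one {a : ℝ} (ha : 0 < a) : leftInv a 1 = 1 / 2 := by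
  have := leftInv_leftMap ha (y := 1 / 2) (by norm_num)
  rwa [leftMap_half] at this

lemma leftInv_mem_Ioc {a x : ℝ} (ha : 0 < a) (hx : x ∈ Set.Ioc (0 : ℝ) 1) :
    leftInv a x ∈ Set.Ioc (0 : ℝ) (1 / 2) := by
  have h := leftInv_mem_Icc ha (Set.Ioc_subset_Icc_self hx)
  refine ⟨lt_of_le_of_ne h.1 fun h0 => ?_, h.2⟩
  have := leftMap_leftInv ha (Set.Ioc_subset_Icc_self hx)
  rw [← h0, leftMap_zero] at this
  exact hx.1.ne this

lemma leftInv_mem_unit {a x : ℝ} (ha : 0 < a) (hx : x ∈ Set.Ioc (0 : ℝ) 1) :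
    leftInv a x ∈ Set.Ioc (0 : ℝ) 1 :=
  Set.Ioc_subset_Ioc_right (by norm_num) (leftInv_mem_Ioc ha hx)

lemma rightInv_mem_unit {x : ℝ} (hx : x ∈ Set.Ioc (0 : ℝ) 1) :
    (x + 1) / 2 ∈ Set.Ioc (0 : ℝ) 1 :=
  ⟨by linarith [hx.1], by linarith [hx.2]⟩

lemma leftInv_mono {a x y : ℝ} (ha : 0 < a) (hx : x ∈ Set.Ioc (0 : ℝ) 1)
    (hy : y ∈ Set.Ioc (0 : ℝ) 1) (hxy : x ≤ y) : leftInv a x ≤ leftInv a y := by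
  refine leftInv_le ha (Set.Ioc_subset_Icc_self hx) (leftInv_mem_Ioc ha hy).1.le ?_
  rwa [leftMap_leftInv ha (Set.Ioc_subset_Icc_self hy)]

lemma leftInv_sub_le {a x y : ℝ} (ha : 0 < a) (hx : x ∈ Set.Ioc (0 : ℝ) 1)
    (hy : y ∈ Set.Ioc (0 : ℝ) 1) (hxy : x ≤ y) : leftInv a y - leftInv a x ≤ y - x := by
  have := sub_le_leftMap_sub ha (leftInv_mem_Ioc ha hx).1.le (leftInv_mono ha hx hy hxy)
  rwa [leftMap_leftInv ha (Set.Ioc_subset_Icc_self hx),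
    leftMap_leftInv ha (Set.Ioc_subset_Icc_self hy)] at this

lemma pmMap_of_lt {a x : ℝ} (hx : x < 1 / 2) : pmMap a x = leftMap a x := by
  simp only [pmMap, leftMap, if_pos hx]

lemma pmMap_of_ge {a x : ℝ} (hx : 1 / 2 ≤ x) : pmMap a x = 2 * x - 1 := by
  simp only [pmMap, if_neg hx.not_gt]

lemma measurable_pmMap {a : ℝ} (ha : 0 < a) : Measurable (pmMap a) := by
  refine Measurable.ite measurableSet_Iio (continuous_leftMap ha).measurable ?_
  fun_prop

lemma pmMap_leftInv {a x : ℝ} (ha : 0 < a) (hx : x ∈ Set.Ioo (0 : ℝ) 1) :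
    pmMap a (leftInv a x) = x := by
  have hx' := Set.Ioo_subset_Icc_self hx
  have h := leftMap_leftInv ha hx'
  rcases lt_or_ge (leftInv a x) (1 / 2) with h2 | h2
  · rw [pmMap_of_lt h2, h]
  · have h3 := le_antisymm (leftInv_mem_Icc ha hx').2 h2
    rw [h3, leftMap_half] at h
    exact absurd h hx.2.ne'

lemma pmMap_rightInv (a : ℝ) {x : ℝ} (hx : 0 ≤ x) : pmMap a ((x + 1) / 2) = x := by
  rw [pmMap_of_ge (by linarith)]; ring

lemma transfer_mul_comp {a x : ℝ} (ha : 0 < a) (f g : ℝ → ℝ) (hx : x ∈ Set.Ioo (0 : ℝ) 1) :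
    transfer a (fun y => f y * g (pmMap a y)) x = transfer a f x * g x := by
  simp only [transfer, pmMap_leftInv ha hx, pmMap_rightInv a hx.1.le]
  ring

/-! ### Lebesgue measure and change of variables -/

lemma leb_eq_Ioo : leb = volume.restrict (Set.Ioo (0 : ℝ) 1) :=
  (Measure.restrict_congr_set Ioo_ae_eq_Icc).symm

lemma leb_eq_Ioc : leb = volume.restrict (Set.Ioc (0 : ℝ) 1) :=
  (Measure.restrict_congr_set Ioc_ae_eq_Icc).symm

instance : IsProbabilityMeasure leb := ⟨by simp [leb]⟩

lemma ae_leb_of_forall {p : ℝ → Prop} (h : ∀ x ∈ Set.Ioo (0 : ℝ) 1, p x) : ∀ᵐ x ∂leb, p x := by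
  rw [leb_eq_Ioo]; exact ae_restrict_of_forall_mem measurableSet_Ioo h

lemma leftMap_image_Ioo {a : ℝ} (ha : 0 < a) :
    leftMap a '' Set.Ioo 0 (1 / 2) = Set.Ioo 0 1 := by
  ext x
  constructor
  · rintro ⟨y, hy, rfl⟩
    have hm := strictMonoOn_leftMap ha
    constructor
    · rw [← leftMap_zero a]; exact hm Set.self_mem_Ici hy.1.le hy.1
    · rw [← leftMap_half a]; exact hm hy.1.le (by norm_num : (0 : ℝ) ≤ 1 / 2) hy.2
  · intro hx
    have hx' := Set.Ioo_subset_Icc_self hx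
    have h := leftInv_mem_Ioc ha ⟨hx.1, hx.2.le⟩
    have h1 := leftMap_leftInv ha hx'
    refine ⟨leftInv a x, ⟨h.1, lt_of_le_of_ne h.2 fun h3 => ?_⟩, h1⟩
    rw [h3, leftMap_half] at h1
    exact hx.2.ne' h1

lemma rightMap_image_Ioo :
    (fun x : ℝ => 2 * x - 1) '' Set.Ioo (1 / 2) 1 = Set.Ioo 0 1 := by
  ext x
  constructor
  · rintro ⟨y, hy, rfl⟩
    exact ⟨by dsimp only; linarith [hy.1], by dsimp only; linarith [hy.2]⟩
  · intro hx
    exact ⟨(x + 1) / 2, ⟨by linarith [hx.1], by linarith [hx.2]⟩, by ring⟩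

lemma hasDerivAt_rightMap (x : ℝ) : HasDerivAt (fun x : ℝ => 2 * x - 1) 2 x := by
  simpa using ((hasDerivAt_id x).const_mul 2).sub_const 1

lemma leftMap_injOn {a : ℝ} (ha : 0 < a) : Set.InjOn (leftMap a) (Set.Ioo 0 (1 / 2)) :=
  (strictMonoOn_leftMap ha).injOn.mono fun _ h => h.1.le

lemma rightMap_injOn (s : Set ℝ) : Set.InjOn (fun x : ℝ => 2 * x - 1) s := by
  intro x _ y _ h
  dsimp only at h
  linarith

lemma integrable_iff_halves {F : ℝ → ℝ} (hF : Integrable F leb) :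
    IntegrableOn F (Set.Ioo 0 (1 / 2)) ∧ IntegrableOn F (Set.Ioo (1 / 2) 1) := by
  rw [leb_eq_Ioo] at hF
  exact ⟨IntegrableOn.mono_set hF (Set.Ioo_subset_Ioo_right (by norm_num)),
    IntegrableOn.mono_set hF (Set.Ioo_subset_Ioo_left (by norm_num))⟩

lemma integral_leb_eq_halves {F : ℝ → ℝ} (hF : Integrable F leb) :
    ∫ x, F x ∂leb = (∫ x in Set.Ioo 0 (1 / 2), F x) + ∫ x in Set.Ioo (1 / 2) 1, F x := by
  rw [leb_eq_Ioc] at hF ⊢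
  rw [← integral_Ioc_eq_integral_Ioo, ← integral_Ioc_eq_integral_Ioo,
    ← setIntegral_union (Set.Ioc_disjoint_Ioc_of_le le_rfl) measurableSet_Ioc
      (IntegrableOn.mono_set hF (Set.Ioc_subset_Ioc_right (by norm_num)))
      (IntegrableOn.mono_set hF (Set.Ioc_subset_Ioc_left (by norm_num))),
    Set.Ioc_union_Ioc_eq_Ioc (by norm_num) (by norm_num)]

lemma leftBranch_smul {a x : ℝ} (ha : 0 < a) (F : ℝ → ℝ) (hx : x ∈ Set.Ioo (0 : ℝ) (1 / 2)) :
    |slope a x| • (F (leftInv a (leftMap a x)) / slope a (leftInv a (leftMap a x))) = F x := by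
  have := slope_pos ha hx.1.le
  rw [leftInv_leftMap ha (Set.Ioo_subset_Icc_self hx), abs_of_pos this, smul_eq_mul]
  field_simp

lemma rightBranch_smul (F : ℝ → ℝ) (x : ℝ) :
    |(2 : ℝ)| • (F ((2 * x - 1 + 1) / 2) / 2) = F x := by
  rw [abs_of_pos two_pos, smul_eq_mul, show (2 * x - 1 + 1) / 2 = x by ring]; ring

lemma integrableOn_leftBranch {a : ℝ} (ha : 0 < a) {F : ℝ → ℝ}
    (hF : IntegrableOn F (Set.Ioo 0 (1 / 2))) :
    IntegrableOn (fun x => F (leftInv a x) / slope a (leftInv a x)) (Set.Ioo 0 1) := by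
  rw [← leftMap_image_Ioo ha, integrableOn_image_iff_integrableOn_abs_deriv_smul
    measurableSet_Ioo (fun x hx => (hasDerivAt_leftMap a hx.1).hasDerivWithinAt)
    (leftMap_injOn ha)]
  exact hF.congr_fun (fun x hx => (leftBranch_smul ha F hx).symm) measurableSet_Ioo

lemma integral_leftBranch {a : ℝ} (ha : 0 < a) (F : ℝ → ℝ) :
    ∫ x in Set.Ioo 0 1, F (leftInv a x) / slope a (leftInv a x) =
      ∫ x in Set.Ioo 0 (1 / 2), F x := by
  rw [← leftMap_image_Ioo ha, integral_image_eq_integral_abs_deriv_smul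
    measurableSet_Ioo (fun x hx => (hasDerivAt_leftMap a hx.1).hasDerivWithinAt)
    (leftMap_injOn ha)]
  exact setIntegral_congr_fun measurableSet_Ioo fun x hx => leftBranch_smul ha F hx

lemma integrableOn_rightBranch {F : ℝ → ℝ} (hF : IntegrableOn F (Set.Ioo (1 / 2) 1)) :
    IntegrableOn (fun x => F ((x + 1) / 2) / 2) (Set.Ioo 0 1) := by
  rw [← rightMap_image_Ioo, integrableOn_image_iff_integrableOn_abs_deriv_smul
    measurableSet_Ioo (fun x _ => (hasDerivAt_rightMap x).hasDerivWithinAt) (rightMap_injOn _)]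
  exact hF.congr_fun (fun x _ => (rightBranch_smul F x).symm) measurableSet_Ioo

lemma integral_rightBranch (F : ℝ → ℝ) :
    ∫ x in Set.Ioo 0 1, F ((x + 1) / 2) / 2 = ∫ x in Set.Ioo (1 / 2) 1, F x := by
  rw [← rightMap_image_Ioo, integral_image_eq_integral_abs_deriv_smul
    measurableSet_Ioo (fun x _ => (hasDerivAt_rightMap x).hasDerivWithinAt) (rightMap_injOn _)]
  exact setIntegral_congr_fun measurableSet_Ioo fun x _ => rightBranch_smul F x

lemma integrable_transfer {a : ℝ} (ha : 0 < a) {F : ℝ → ℝ} (hF : Integrable F leb) :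
    Integrable (transfer a F) leb := by
  obtain ⟨h1, h2⟩ := integrable_iff_halves hF
  rw [leb_eq_Ioo]
  exact (integrableOn_leftBranch ha h1).add (integrableOn_rightBranch h2)

lemma integral_transfer {a : ℝ} (ha : 0 < a) {F : ℝ → ℝ} (hF : Integrable F leb) :
    ∫ x, transfer a F x ∂leb = ∫ x, F x ∂leb := by
  obtain ⟨h1, h2⟩ := integrable_iff_halves hF
  rw [integral_leb_eq_halves hF, leb_eq_Ioo, ← integral_leftBranch ha, ← integral_rightBranch]
  exact integral_add (integrableOn_leftBranch ha h1) (integrableOn_rightBranch h2)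

/-- Duality between the transfer operator and composition with the map. -/
lemma integral_transfer_mul {a : ℝ} (ha : 0 < a) {f g : ℝ → ℝ}
    (h : Integrable (fun x => f x * g (pmMap a x)) leb) :
    ∫ x, transfer a f x * g x ∂leb = ∫ x, f x * g (pmMap a x) ∂leb := by
  rw [← integral_transfer ha h]
  exact integral_congr_ae (ae_leb_of_forall fun x hx => (transfer_mul_comp ha f g hx).symm)

lemma volume_le_image {s : Set ℝ} {f f' : ℝ → ℝ} (hs : MeasurableSet s)
    (hf : ∀ x ∈ s, HasDerivAt f (f' x) x) (hf' : ∀ x ∈ s, 1 ≤ f' x) (hinj : Set.InjOn f s) :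
    volume s ≤ volume (f '' s) := by
  have h := lintegral_image_eq_lintegral_abs_deriv_mul hs
    (fun x hx => (hf x hx).hasDerivWithinAt) hinj (fun _ => 1)
  rw [setLIntegral_one] at h
  rw [h, ← setLIntegral_one]
  refine setLIntegral_mono' hs fun x hx => ?_
  rw [mul_one, ← ENNReal.ofReal_one]
  exact ENNReal.ofReal_le_ofReal ((hf' x hx).trans (le_abs_self _))

/-- Preimages of Lebesgue null sets are Lebesgue null sets, because both branches expand. -/
lemma quasiMeasurePreserving_pmMap {a : ℝ} (ha : 0 < a) :
    Measure.QuasiMeasurePreserving (pmMap a) leb leb := by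
  refine ⟨measurable_pmMap ha, Measure.AbsolutelyContinuous.mk fun A hA h0 => ?_⟩
  have hm := measurable_pmMap ha hA
  rw [Measure.map_apply (measurable_pmMap ha) hA]
  rw [leb_eq_Ioo, Measure.restrict_apply hA] at h0
  rw [leb_eq_Ioc, Measure.restrict_apply hm]
  have hL : volume (pmMap a ⁻¹' A ∩ Set.Ioo 0 (1 / 2)) = 0 := by
    refine le_antisymm ((volume_le_image (hm.inter measurableSet_Ioo)
      (fun x hx => hasDerivAt_leftMap a hx.2.1) (fun x hx => one_le_slope ha hx.2.1.le)
      ((leftMap_injOn ha).mono Set.inter_subset_right)).trans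
      ((measure_mono ?_).trans h0.le)) zero_le
    rintro _ ⟨x, ⟨hx, hx2⟩, rfl⟩
    refine ⟨?_, ?_⟩
    · rw [← pmMap_of_lt hx2.2]; exact hx
    · rw [← leftMap_image_Ioo ha]; exact Set.mem_image_of_mem _ hx2
  have hR : volume (pmMap a ⁻¹' A ∩ Set.Ioo (1 / 2) 1) = 0 := by
    refine le_antisymm ((volume_le_image (hm.inter measurableSet_Ioo)
      (fun x _ => hasDerivAt_rightMap x) (fun x _ => one_le_two)
      (rightMap_injOn _)).trans
      ((measure_mono ?_).trans h0.le)) zero_le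
    rintro _ ⟨x, ⟨hx, hx2⟩, rfl⟩
    refine ⟨?_, ?_⟩
    · dsimp only; rw [← pmMap_of_ge (a := a) hx2.1.le]; exact hx
    · rw [← rightMap_image_Ioo]; exact Set.mem_image_of_mem (fun x : ℝ => 2 * x - 1) hx2
  have hsub : pmMap a ⁻¹' A ∩ Set.Ioc 0 1 ⊆
      (pmMap a ⁻¹' A ∩ Set.Ioo 0 (1 / 2)) ∪ (pmMap a ⁻¹' A ∩ Set.Ioo (1 / 2) 1) ∪
        ({1 / 2, 1} : Set ℝ) := by
    rintro x ⟨hx, hx0, hx1⟩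
    rcases lt_trichotomy x (1 / 2) with h | h | h
    · exact Or.inl (Or.inl ⟨hx, hx0, h⟩)
    · exact Or.inr (Or.inl h)
    · rcases hx1.lt_or_eq with h1 | h1
      · exact Or.inl (Or.inr ⟨hx, h, h1⟩)
      · exact Or.inr (Or.inr h1)
  refine measure_mono_null hsub (measure_union_null (measure_union_null hL hR) ?_)
  exact (Set.toFinite _).measure_zero _

/-! ### Decreasing densities -/

/-- The constant in the pointwise bound of `DecDensity`. Any constant which is at least
`6 / (1 - β)` is preserved by the transfer operators, and this one also dominates the constant
`2 ^ β * (2 + β)` of `InCone`. -/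
def coneConst (β : ℝ) : ℝ := 6 / (1 - β)

/-- Decreasing densities on `(0,1]` of mass at most `M` with a singularity at `0` of order at
most `x ^ (-β)`. The pointwise bound refers to `M` rather than to the mass of `g`, so that it is
not affected by subtracting constants. -/
structure DecDensity (β M : ℝ) (g : ℝ → ℝ) : Prop where
  integrable : Integrable g leb
  nonneg : ∀ x ∈ Set.Ioc (0 : ℝ) 1, 0 ≤ g x
  anti : AntitoneOn g (Set.Ioc 0 1)
  le_rpow : ∀ x ∈ Set.Ioc (0 : ℝ) 1, g x ≤ coneConst β * M * x ^ (-β)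
  mass_le : ∫ x, g x ∂leb ≤ M

lemma ae_leb_Ioc : ∀ᵐ x ∂leb, x ∈ Set.Ioc (0 : ℝ) 1 :=
  ae_leb_of_forall fun _ hx => Set.Ioo_subset_Ioc_self hx

lemma integral_leb_nonneg {g : ℝ → ℝ} (hg : ∀ x ∈ Set.Ioc (0 : ℝ) 1, 0 ≤ g x) :
    0 ≤ ∫ x, g x ∂leb :=
  integral_nonneg_of_ae (ae_leb_Ioc.mono fun x hx => hg x hx)

lemma integral_leb_mono {f g : ℝ → ℝ} (hf : Integrable f leb) (hg : Integrable g leb)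
    (h : ∀ x ∈ Set.Ioc (0 : ℝ) 1, f x ≤ g x) : ∫ x, f x ∂leb ≤ ∫ x, g x ∂leb :=
  integral_mono_ae hf hg (ae_leb_Ioc.mono fun x hx => h x hx)

lemma transfer_mono {a x : ℝ} (ha : 0 < a) {f g : ℝ → ℝ}
    (h : ∀ x ∈ Set.Ioc (0 : ℝ) 1, f x ≤ g x) (hx : x ∈ Set.Ioc (0 : ℝ) 1) :
    transfer a f x ≤ transfer a g x := by
  have h1 := h _ (leftInv_mem_unit ha hx)
  have h2 := h _ (rightInv_mem_unit hx)
  have h3 := slope_pos ha (leftInv_mem_Ioc ha hx).1.le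
  unfold transfer
  gcongr

lemma transfer_nonneg {a x : ℝ} (ha : 0 < a) {g : ℝ → ℝ}
    (h : ∀ x ∈ Set.Ioc (0 : ℝ) 1, 0 ≤ g x) (hx : x ∈ Set.Ioc (0 : ℝ) 1) :
    0 ≤ transfer a g x := by
  have := transfer_mono ha h hx
  simpa [transfer] using this

/-- Decreasing densities stay decreasing because `slope` is increasing, that is, the left branch
is convex. -/
lemma transfer_antitoneOn {a : ℝ} (ha : 0 < a) {g : ℝ → ℝ}
    (h : ∀ x ∈ Set.Ioc (0 : ℝ) 1, 0 ≤ g x) (hg : AntitoneOn g (Set.Ioc 0 1)) :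
    AntitoneOn (transfer a g) (Set.Ioc 0 1) := by
  intro x hx y hy hxy
  have h1 := leftInv_mono ha hx hy hxy
  have h2 := hg (leftInv_mem_unit ha hx) (leftInv_mem_unit ha hy) h1
  have h3 := slope_pos ha (leftInv_mem_Ioc ha hx).1.le
  have h4 := slope_mono ha (leftInv_mem_Ioc ha hx).1.le h1
  have h5 := hg (rightInv_mem_unit hx) (rightInv_mem_unit hy) (by linarith)
  have h6 := h _ (leftInv_mem_unit ha hx)
  unfold transfer
  gcongr

lemma mul_le_integral_of_antitoneOn {g : ℝ → ℝ} (hi : Integrable g leb)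
    (h : ∀ x ∈ Set.Ioc (0 : ℝ) 1, 0 ≤ g x) (hg : AntitoneOn g (Set.Ioc 0 1)) {x : ℝ}
    (hx : x ∈ Set.Ioc (0 : ℝ) 1) : x * g x ≤ ∫ y, g y ∂leb := by
  have h1 : ∫ y, (Set.Ioc 0 x).indicator (fun _ => g x) y ∂leb = x * g x := by
    rw [integral_indicator measurableSet_Ioc, setIntegral_const, leb_eq_Ioc,
      Measure.real, Measure.restrict_apply measurableSet_Ioc,
      Set.inter_eq_left.2 (Set.Ioc_subset_Ioc_right hx.2), Real.volume_Ioc, sub_zero,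
      ENNReal.toReal_ofReal hx.1.le, smul_eq_mul]
  rw [← h1]
  refine integral_leb_mono ((integrable_const _).indicator measurableSet_Ioc) hi fun y hy => ?_
  by_cases hyx : y ∈ Set.Ioc 0 x
  · rw [Set.indicator_of_mem hyx]; exact hg hy hx hyx.2
  · rw [Set.indicator_of_notMem hyx]; exact h y hy

lemma two_mul_rpow_le_one {a y : ℝ} (ha : 0 < a) (hy : y ∈ Set.Ioc (0 : ℝ) (1 / 2)) :
    (2 : ℝ) ^ a * y ^ a ≤ 1 := by
  rw [← Real.mul_rpow zero_le_two hy.1.le]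
  exact Real.rpow_le_one (by linarith [hy.1]) (by linarith [hy.2]) ha.le

lemma two_mul_rpow_anti {a β y : ℝ} (haβ : a ≤ β) (hy : y ∈ Set.Ioc (0 : ℝ) (1 / 2)) :
    (2 : ℝ) ^ β * y ^ β ≤ (2 : ℝ) ^ a * y ^ a := by
  rw [← Real.mul_rpow zero_le_two hy.1.le, ← Real.mul_rpow zero_le_two hy.1.le]
  exact Real.rpow_le_rpow_of_exponent_ge (by linarith [hy.1]) (by linarith [hy.2]) haβ

/-- The bound by a multiple of `x ^ (-β)` survives the transfer operator: what the neutral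
branch gains, of relative order `(2 y) ^ a`, pays for the bounded contribution of the right
branch. -/
lemma transfer_le_rpow {a β M x : ℝ} (ha : 0 < a) (haβ : a ≤ β) (hβ1 : β < 1) {g : ℝ → ℝ}
    (hg : DecDensity β M g) (hx : x ∈ Set.Ioc (0 : ℝ) 1) :
    transfer a g x ≤ coneConst β * M * x ^ (-β) := by
  have hM : 0 ≤ M := (integral_leb_nonneg hg.nonneg).trans hg.mass_le
  have hβ0 : 0 < β := ha.trans_le haβ
  have hy := leftInv_mem_Ioc ha hx
  have hxy : leftInv a x * (1 + (2 : ℝ) ^ a * leftInv a x ^ a) = x :=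
    leftMap_leftInv ha (Set.Ioc_subset_Icc_self hx)
  have hgy := hg.le_rpow _ (leftInv_mem_unit ha hx)
  have h1 := two_mul_rpow_le_one ha hy
  have h2 := two_mul_rpow_anti haβ hy
  have h3 : g ((x + 1) / 2) ≤ 2 * M := by
    have h4 := mul_le_integral_of_antitoneOn hg.integrable hg.nonneg hg.anti (rightInv_mem_unit hx)
    have h5 := hg.mass_le
    have h6 := hg.nonneg _ (rightInv_mem_unit hx)
    have h7 := hx.1
    nlinarith
  have hs : slope a (leftInv a x) = 1 + (1 + a) * ((2 : ℝ) ^ a * leftInv a x ^ a) := by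
    rw [slope]; ring
  unfold transfer
  rw [hs]
  generalize leftInv a x = y at *
  set ξ := (2 : ℝ) ^ a * y ^ a with hξ
  have hy0 := hy.1
  have hξ0 : 0 < ξ := by positivity
  have hxpow : x ^ β = y ^ β * (1 + ξ) ^ β := by
    rw [← hxy, Real.mul_rpow hy0.le (by linarith)]
  have hbern : (1 + ξ) ^ β ≤ 1 + β * ξ :=
    rpow_one_add_le_one_add_mul_self (by linarith) hβ0.le hβ1.le
  have hxξ : x ^ β ≤ ξ := by
    refine le_trans ?_ h2
    rw [← Real.mul_rpow zero_le_two hy0.le]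
    refine Real.rpow_le_rpow hx.1.le ?_ hβ0.le
    rw [← hxy]; nlinarith
  have hx0 : 0 < x ^ β := Real.rpow_pos_of_pos hx.1 _
  have hyβ : 0 < y ^ β := Real.rpow_pos_of_pos hy0 _
  set A := coneConst β with hA
  have hA1 : A * (1 - β) = 6 := by
    rw [hA, coneConst]; field_simp [(sub_pos.2 hβ1).ne']
  have hA0 : 0 < A := by rw [hA, coneConst]; exact div_pos (by norm_num) (sub_pos.2 hβ1)
  rw [Real.rpow_neg hx.1.le, ← div_eq_mul_inv, le_div_iff₀ hx0]
  rw [Real.rpow_neg hy0.le, ← div_eq_mul_inv, le_div_iff₀ hyβ] at hgy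
  have hD : 0 < 1 + (1 + a) * ξ := by positivity
  have hleft : g y / (1 + (1 + a) * ξ) * x ^ β ≤ A * M * (1 + β * ξ) / (1 + (1 + a) * ξ) := by
    rw [div_mul_eq_mul_div, div_le_div_iff_of_pos_right hD, hxpow]
    calc g y * (y ^ β * (1 + ξ) ^ β) = (g y * y ^ β) * (1 + ξ) ^ β := by ring
      _ ≤ (A * M) * (1 + β * ξ) := by gcongr
  have hright : g ((x + 1) / 2) / 2 * x ^ β ≤ M * ξ := by
    have : g ((x + 1) / 2) / 2 ≤ M := by linarith
    gcongr
  have hgain : M * ξ ≤ A * M - A * M * (1 + β * ξ) / (1 + (1 + a) * ξ) := by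
    rw [le_sub_iff_add_le, ← le_sub_iff_add_le', div_le_iff₀ hD]
    have e0 : (1 + a) * ξ ≤ 2 * 1 := by
      have : 1 + a ≤ 2 := by linarith
      gcongr
    have e1 : ξ * (1 + (1 + a) * ξ) ≤ 3 * ξ := by nlinarith
    have e2 : A * (1 + (1 + a) * ξ) - A * (1 + β * ξ) = 6 * ξ + A * a * ξ := by
      linear_combination ξ * hA1
    have e3 : 0 ≤ A * a * ξ := by positivity
    have e4 : A * (1 + β * ξ) ≤ (A - ξ) * (1 + (1 + a) * ξ) := by nlinarith
    nlinarith [mul_le_mul_of_nonneg_left e4 hM]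
  linarith

lemma DecDensity.transfer {a β M : ℝ} (ha : 0 < a) (haβ : a ≤ β) (hβ1 : β < 1) {g : ℝ → ℝ}
    (hg : DecDensity β M g) : DecDensity β M (transfer a g) where
  integrable := integrable_transfer ha hg.integrable
  nonneg _ hx := transfer_nonneg ha hg.nonneg hx
  anti := transfer_antitoneOn ha hg.nonneg hg.anti
  le_rpow _ hx := transfer_le_rpow ha haβ hβ1 hg hx
  mass_le := by rw [integral_transfer ha hg.integrable]; exact hg.mass_le

/-! ### Compositions of transfer operators -/

/-- The transfer operator of `compMap α n`. -/
def transferIter (α : ℕ → ℝ) : ℕ → (ℝ → ℝ) → ℝ → ℝ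
  | 0, f => f
  | n + 1, f => transfer (α (n + 1)) (transferIter α n f)

lemma transferIter_add (α : ℕ → ℝ) (n m : ℕ) (f : ℝ → ℝ) :
    transferIter α (n + m) f = transferIter (fun i => α (n + i)) m (transferIter α n f) := by
  induction m with
  | zero => rfl
  | succ m ih => rw [← add_assoc, transferIter, ih, transferIter, add_assoc]

lemma compMap_add (α : ℕ → ℝ) (n m : ℕ) :
    compMap α (n + m) = compMap (fun i => α (n + i)) m ∘ compMap α n := by
  induction m with
  | zero => rfl
  | succ m ih => rw [← add_assoc, compMap, ih, compMap, add_assoc]; rfl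

lemma transferIter_succ' (α : ℕ → ℝ) (n : ℕ) (f : ℝ → ℝ) :
    transferIter α (n + 1) f = transferIter (fun i => α (1 + i)) n (transfer (α 1) f) := by
  rw [add_comm, transferIter_add]; rfl

lemma Admissible.shift {β : ℝ} {α : ℕ → ℝ} (h : Admissible β α) (n : ℕ) :
    Admissible β fun i => α (n + i) := fun i hi => h _ (by omega)

lemma Admissible.pos {β : ℝ} {α : ℕ → ℝ} (h : Admissible β α) (n : ℕ) : 0 < α (n + 1) :=
  (h _ (by omega)).1

lemma DecDensity.transferIter {β M : ℝ} {α : ℕ → ℝ} (hα : Admissible β α) (hβ1 : β < 1)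
    {g : ℝ → ℝ} (hg : DecDensity β M g) (n : ℕ) : DecDensity β M (transferIter α n g) := by
  induction n with
  | zero => exact hg
  | succ n ih => exact ih.transfer (hα.pos n) (hα _ (by omega)).2 hβ1

lemma integrable_transferIter {β : ℝ} {α : ℕ → ℝ} (hα : Admissible β α) {f : ℝ → ℝ}
    (hf : Integrable f leb) (n : ℕ) : Integrable (transferIter α n f) leb := by
  induction n with
  | zero => exact hf
  | succ n ih => exact integrable_transfer (hα.pos n) ih

lemma integral_transferIter {β : ℝ} {α : ℕ → ℝ} (hα : Admissible β α) {f : ℝ → ℝ}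
    (hf : Integrable f leb) (n : ℕ) :
    ∫ x, transferIter α n f x ∂leb = ∫ x, f x ∂leb := by
  induction n with
  | zero => rfl
  | succ n ih =>
    rw [← ih]; exact integral_transfer (hα.pos n) (integrable_transferIter hα hf n)

lemma transferIter_mono {β : ℝ} {α : ℕ → ℝ} (hα : Admissible β α) {f g : ℝ → ℝ}
    (h : ∀ x ∈ Set.Ioc (0 : ℝ) 1, f x ≤ g x) (n : ℕ) :
    ∀ x ∈ Set.Ioc (0 : ℝ) 1, transferIter α n f x ≤ transferIter α n g x := by
  induction n with
  | zero => exact h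
  | succ n ih => exact fun x hx => transfer_mono (hα.pos n) ih hx

lemma transferIter_congr {β : ℝ} {α : ℕ → ℝ} (hα : Admissible β α) {f g : ℝ → ℝ}
    (h : ∀ x ∈ Set.Ioc (0 : ℝ) 1, f x = g x) (n : ℕ) {x : ℝ} (hx : x ∈ Set.Ioc (0 : ℝ) 1) :
    transferIter α n f x = transferIter α n g x :=
  le_antisymm (transferIter_mono hα (fun y hy => (h y hy).le) n x hx)
    (transferIter_mono hα (fun y hy => (h y hy).ge) n x hx)

lemma transferIter_nonneg {β : ℝ} {α : ℕ → ℝ} (hα : Admissible β α) {f : ℝ → ℝ}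
    (h : ∀ x ∈ Set.Ioc (0 : ℝ) 1, 0 ≤ f x) (n : ℕ) :
    ∀ x ∈ Set.Ioc (0 : ℝ) 1, 0 ≤ transferIter α n f x := by
  induction n with
  | zero => exact h
  | succ n ih => exact fun x hx => transfer_nonneg (hα.pos n) ih hx

lemma transferIter_add_mul (α : ℕ → ℝ) (n : ℕ) (f g : ℝ → ℝ) (c : ℝ) :
    transferIter α n (fun x => f x + c * g x) =
      fun x => transferIter α n f x + c * transferIter α n g x := by
  induction n with
  | zero => rfl
  | succ n ih =>
    ext x
    simp only [transferIter, ih, transfer]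
    ring

lemma transferIter_sub (α : ℕ → ℝ) (n : ℕ) (f g : ℝ → ℝ) :
    transferIter α n (fun x => f x - g x) =
      fun x => transferIter α n f x - transferIter α n g x := by
  have := transferIter_add_mul α n f g (-1)
  simpa [sub_eq_add_neg] using this

/-! ### A uniform lower bound for the images of the constant density -/

lemma coneConst_ge {β : ℝ} (hβ0 : 0 < β) (hβ1 : β < 1) : 6 ≤ coneConst β := by
  rw [coneConst, le_div_iff₀ (by linarith)]; linarith

lemma one_le_rpow_neg {β x : ℝ} (hβ0 : 0 < β) (hx : x ∈ Set.Ioc (0 : ℝ) 1) : 1 ≤ x ^ (-β) :=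
  Real.one_le_rpow_of_pos_of_le_one_of_nonpos hx.1 hx.2 (by linarith)

lemma decDensity_one {β : ℝ} (hβ0 : 0 < β) (hβ1 : β < 1) : DecDensity β 1 fun _ => 1 where
  integrable := integrable_const _
  nonneg _ _ := zero_le_one
  anti _ _ _ _ _ := le_rfl
  le_rpow x hx := by
    have := coneConst_ge hβ0 hβ1
    have := one_le_rpow_neg hβ0 hx
    nlinarith
  mass_le := by simp

lemma integrable_rpow_neg {β : ℝ} (hβ1 : β < 1) : Integrable (fun x : ℝ => x ^ (-β)) leb := by
  rw [leb_eq_Ioc]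
  exact (intervalIntegral.intervalIntegrable_rpow' (by linarith : -1 < -β)).1

lemma setIntegral_rpow_neg {β t : ℝ} (hβ1 : β < 1) (ht : t ∈ Set.Ioc (0 : ℝ) 1) :
    ∫ x in Set.Ioc 0 t, x ^ (-β) ∂leb = t ^ (1 - β) / (1 - β) := by
  rw [leb_eq_Ioc, Measure.restrict_restrict measurableSet_Ioc,
    Set.inter_eq_left.2 (Set.Ioc_subset_Ioc_right ht.2),
    ← intervalIntegral.integral_of_le ht.1.le,
    integral_rpow (Or.inl (by linarith : -1 < -β)), Real.zero_rpow (by linarith), sub_zero,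
    neg_add_eq_sub]

lemma DecDensity.setIntegral_Ioc_le {β M : ℝ} (hβ1 : β < 1) {g : ℝ → ℝ} (hg : DecDensity β M g)
    {t : ℝ} (ht : t ∈ Set.Ioc (0 : ℝ) 1) :
    ∫ x in Set.Ioc 0 t, g x ∂leb ≤ coneConst β * M * (t ^ (1 - β) / (1 - β)) := by
  rw [← setIntegral_rpow_neg hβ1 ht, ← integral_const_mul]
  refine setIntegral_mono_on hg.integrable.integrableOn
    ((integrable_rpow_neg hβ1).const_mul _).integrableOn measurableSet_Ioc fun x hx => ?_
  exact hg.le_rpow x ⟨hx.1, hx.2.trans ht.2⟩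

/-- A density with mass one is at least `1 / 2` at every point below which it has mass at most
one half. -/
lemma half_le_of_setIntegral_le {g : ℝ → ℝ} (hi : Integrable g leb)
    (h : ∀ x ∈ Set.Ioc (0 : ℝ) 1, 0 ≤ g x) (hg : AntitoneOn g (Set.Ioc 0 1))
    (h1 : ∫ x, g x ∂leb = 1) {t : ℝ} (ht : t ∈ Set.Ioc (0 : ℝ) 1)
    (hle : ∫ x in Set.Ioc 0 t, g x ∂leb ≤ 1 / 2) : 1 / 2 ≤ g t := by
  have h2 := integral_add_compl (measurableSet_Ioc (a := (0 : ℝ)) (b := t)) hi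
  have h3 : ∫ x in (Set.Ioc 0 t)ᶜ, g x ∂leb ≤ ∫ x in (Set.Ioc 0 t)ᶜ, g t ∂leb := by
    refine integral_mono_ae hi.integrableOn (integrable_const _) ?_
    rw [Filter.EventuallyLE, ae_restrict_iff' measurableSet_Ioc.compl]
    filter_upwards [ae_leb_Ioc] with x hx hx'
    refine hg ht hx (le_of_not_ge fun hxt => hx' ⟨hx.1, hxt⟩)
  have h4 : ∫ x in (Set.Ioc 0 t)ᶜ, g t ∂leb ≤ g t := by
    rw [setIntegral_const, smul_eq_mul]
    have : leb.real (Set.Ioc 0 t)ᶜ ≤ 1 := measureReal_le_one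
    nlinarith [h t ht]
  linarith

lemma leftMap_ge {a β τ x : ℝ} (haβ : a ≤ β) (hβ0 : 0 < β) (hτ : 0 < τ)
    (hx : x ∈ Set.Icc τ (1 / 2)) : (1 + τ ^ β) * x ≤ leftMap a x := by
  have hx0 : 0 < x := hτ.trans_le hx.1
  have h1 := two_mul_rpow_anti haβ ⟨hx0, hx.2⟩
  have h2 : τ ^ β ≤ (2 : ℝ) ^ β * x ^ β := by
    rw [← Real.mul_rpow zero_le_two hx0.le]
    exact Real.rpow_le_rpow hτ.le (by linarith [hx.1]) hβ0.le
  unfold leftMap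
  nlinarith

lemma third_le_transfer {a x z : ℝ} (ha : 0 < a) (ha1 : a ≤ 1) {g : ℝ → ℝ}
    (h : ∀ x ∈ Set.Ioc (0 : ℝ) 1, 0 ≤ g x) (hg : AntitoneOn g (Set.Ioc 0 1))
    (hx : x ∈ Set.Ioc (0 : ℝ) 1) (hz : z ∈ Set.Ioc (0 : ℝ) 1) (hzx : leftInv a z ≤ x) :
    g x / 3 ≤ transfer a g z := by
  have h1 := hg (leftInv_mem_unit ha hz) hx hzx
  have h2 := h _ (rightInv_mem_unit hz)
  have hy := leftInv_mem_Ioc ha hz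
  have h3 := slope_le_three ha ha1 hy.1.le hy.2
  have h4 := slope_pos ha hy.1.le
  have h5 : g x / 3 ≤ g (leftInv a z) / slope a (leftInv a z) := by
    have := h _ hx
    gcongr
    exact h _ (leftInv_mem_unit ha hz)
  unfold transfer
  linarith

lemma leftInv_min_le {a β τ x : ℝ} (ha : 0 < a) (haβ : a ≤ β) (hτ : 0 < τ)
    (hx : x ∈ Set.Icc τ 1) : leftInv a (min 1 ((1 + τ ^ β) * x)) ≤ x := by
  have hβ0 := ha.trans_le haβ
  have hx0 : 0 < x := hτ.trans_le hx.1
  have hmem : min 1 ((1 + τ ^ β) * x) ∈ Set.Ioc (0 : ℝ) 1 :=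
    ⟨lt_min one_pos (by positivity), min_le_left _ _⟩
  rcases le_or_gt x (1 / 2) with h | h
  · exact leftInv_le ha (Set.Ioc_subset_Icc_self hmem) hx0.le
      ((min_le_right _ _).trans (leftMap_ge haβ hβ0 hτ ⟨hx.1, h⟩))
  · exact (leftInv_mem_Ioc ha hmem).2.trans h.le

/-- A lower bound at `τ` spreads to the right at a geometric speed, since every point of
`[τ, 1/2]` is moved by a factor at least `1 + τ ^ β`. -/
lemma transferIter_min_ge {β τ : ℝ} {α : ℕ → ℝ} (hα : Admissible β α) (hβ1 : β < 1)
    (hτ : τ ∈ Set.Ioc (0 : ℝ) 1) {g : ℝ → ℝ}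
    (h : ∀ x ∈ Set.Ioc (0 : ℝ) 1, 0 ≤ g x) (hg : AntitoneOn g (Set.Ioc 0 1)) (n : ℕ) :
    g τ / 3 ^ n ≤ transferIter α n g (min 1 ((1 + τ ^ β) ^ n * τ)) ∧
      (∀ x ∈ Set.Ioc (0 : ℝ) 1, 0 ≤ transferIter α n g x) ∧
      AntitoneOn (transferIter α n g) (Set.Ioc 0 1) := by
  induction n with
  | zero => exact ⟨by simp [transferIter, hτ.2], h, hg⟩
  | succ n ih =>
    obtain ⟨h1, h2, h3⟩ := ih
    have ha := hα.pos n
    have haβ := (hα (n + 1) (by omega)).2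
    refine ⟨?_, fun x hx => transfer_nonneg ha h2 hx, transfer_antitoneOn ha h2 h3⟩
    have hδ : 0 ≤ τ ^ β := Real.rpow_nonneg hτ.1.le _
    have hτn : τ ≤ (1 + τ ^ β) ^ n * τ :=
      le_mul_of_one_le_left hτ.1.le (one_le_pow₀ (by linarith))
    set x := min 1 ((1 + τ ^ β) ^ n * τ) with hx
    have hxm : x ∈ Set.Icc τ 1 := ⟨le_min hτ.2 hτn, min_le_left _ _⟩
    have hx0 : 0 < x := hτ.1.trans_le hxm.1
    have hz : min 1 ((1 + τ ^ β) ^ (n + 1) * τ) = min 1 ((1 + τ ^ β) * x) := by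
      rw [pow_succ', mul_assoc]
      rcases le_total 1 ((1 + τ ^ β) ^ n * τ) with h4 | h4
      · rw [hx, min_eq_left h4, min_eq_left (by nlinarith), min_eq_left (by linarith)]
      · rw [hx, min_eq_right h4]
    rw [hz, pow_succ, ← div_div]
    refine le_trans ?_ (third_le_transfer ha (haβ.trans hβ1.le) h2 h3 ⟨hx0, hxm.2⟩
      ⟨lt_min one_pos (by positivity), min_le_left _ _⟩ (leftInv_min_le ha haβ hτ.1 hxm))
    gcongr

/-- The images of the constant function `1` are bounded below, uniformly in time and in the
sequence of parameters. -/
lemma exists_le_transferIter_one {β : ℝ} (hβ0 : 0 < β) (hβ1 : β < 1) :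
    ∃ γ : ℝ, 0 < γ ∧ γ < 1 ∧ ∀ α : ℕ → ℝ, Admissible β α → ∀ n : ℕ,
      ∀ x ∈ Set.Ioc (0 : ℝ) 1, γ ≤ transferIter α n (fun _ => 1) x := by
  have hA := coneConst_ge hβ0 hβ1
  have h1β : 0 < 1 - β := by linarith
  -- `τ` is chosen so that the mass below it is at most one half
  set τ : ℝ := ((1 - β) / (2 * coneConst β)) ^ (1 / (1 - β)) with hτdef
  have hq0 : 0 < (1 - β) / (2 * coneConst β) := by positivity
  have hq1 : (1 - β) / (2 * coneConst β) ≤ 1 := by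
    rw [div_le_one (by positivity)]; linarith
  have hτ : τ ∈ Set.Ioc (0 : ℝ) 1 :=
    ⟨Real.rpow_pos_of_pos hq0 _, Real.rpow_le_one hq0.le hq1 (by positivity)⟩
  have hτpow : τ ^ (1 - β) = (1 - β) / (2 * coneConst β) := by
    rw [hτdef, ← Real.rpow_mul hq0.le, one_div_mul_cancel h1β.ne', Real.rpow_one]
  have hδ : 1 < 1 + τ ^ β := by linarith [Real.rpow_pos_of_pos hτ.1 β]
  obtain ⟨J, hJ⟩ := pow_unbounded_of_one_lt (1 / τ) hδ
  have hJ1 : 1 ≤ (1 + τ ^ β) ^ J * τ := by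
    rw [div_lt_iff₀ hτ.1] at hJ; exact hJ.le
  have h3J : (1 : ℝ) ≤ 3 ^ J := one_le_pow₀ (by norm_num)
  refine ⟨1 / 2 / 3 ^ J, by positivity, ?_, fun α hα n x hx => ?_⟩
  · rw [div_lt_one (by positivity)]; linarith
  have hD := decDensity_one hβ0 hβ1
  have h1 : (1 : ℝ) ∈ Set.Ioc (0 : ℝ) 1 := by norm_num
  refine le_trans ?_ ((hD.transferIter hα hβ1 n).anti hx h1 hx.2)
  -- before time `J` the bound spreads from the point `1` itself, afterwards from `τ`
  rcases le_total n J with hn | hn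
  · have h := (transferIter_min_ge hα hβ1 h1 hD.nonneg hD.anti n).1
    have hmin : min 1 ((1 + (1 : ℝ) ^ β) ^ n * 1) = 1 :=
      min_eq_left (by
        rw [mul_one, Real.one_rpow]
        exact one_le_pow₀ (by norm_num))
    rw [hmin] at h
    refine le_trans ?_ h
    gcongr <;> norm_num
  · obtain ⟨m, rfl⟩ := Nat.exists_eq_add_of_le' hn
    have hm := hD.transferIter hα hβ1 m
    have hhalf : 1 / 2 ≤ transferIter α m (fun _ => 1) τ := by
      refine half_le_of_setIntegral_le hm.integrable hm.nonneg hm.anti ?_ hτ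
        ((hm.setIntegral_Ioc_le hβ1 hτ).trans ?_)
      · rw [integral_transferIter hα hD.integrable]; simp
      · rw [hτpow]
        apply le_of_eq
        have : coneConst β ≠ 0 := by linarith
        field_simp
    rw [transferIter_add]
    have h := (transferIter_min_ge (hα.shift m) hβ1 hτ hm.nonneg hm.anti J).1
    rw [min_eq_left hJ1] at h
    refine le_trans ?_ h
    gcongr

/-! ### The drift inequality -/

/-- The Lyapunov function `x ^ (-β)`, truncated at the scale `ε` to keep it integrable against
all densities of `DecDensity`. Up to a constant it bounds the time needed to leave a
neighbourhood of the neutral fixed point. -/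
def potential (β ε x : ℝ) : ℝ := (max x ε) ^ (-β)

lemma potential_nonneg {β ε x : ℝ} (hε : 0 < ε) : 0 ≤ potential β ε x :=
  Real.rpow_nonneg (hε.le.trans (le_max_right _ _)) _

lemma potential_le {β ε : ℝ} (hβ0 : 0 < β) (hε : 0 < ε) (x : ℝ) :
    potential β ε x ≤ ε ^ (-β) :=
  Real.rpow_le_rpow_of_nonpos hε (le_max_right _ _) (by linarith)

lemma potential_le_rpow {β ε x : ℝ} (hβ0 : 0 < β) (hx : 0 < x) :
    potential β ε x ≤ x ^ (-β) :=
  Real.rpow_le_rpow_of_nonpos hx (le_max_left _ _) (by linarith)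

lemma one_le_potential {β ε x : ℝ} (hβ0 : 0 < β) (hε : ε ∈ Set.Ioc (0 : ℝ) 1) (hx : x ≤ 1) :
    1 ≤ potential β ε x :=
  one_le_rpow_neg hβ0 ⟨hε.1.trans_le (le_max_right _ _), max_le hx hε.2⟩

lemma continuous_potential {β ε : ℝ} (hε : 0 < ε) : Continuous (potential β ε) := by
  unfold potential
  refine Continuous.rpow_const (by fun_prop) fun x => Or.inl ?_
  exact (hε.trans_le (le_max_right _ _)).ne'

lemma integrable_potential_mul {β ε : ℝ} (hβ0 : 0 < β) (hε : 0 < ε) {φ g : ℝ → ℝ}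
    (hφ : Measurable φ) {ν : Measure ℝ} (hg : Integrable g ν) :
    Integrable (fun x => potential β ε (φ x) * g x) ν := by
  refine hg.bdd_mul (c := ε ^ (-β))
    ((continuous_potential hε).measurable.comp hφ).aestronglyMeasurable
    (Filter.Eventually.of_forall fun x => ?_)
  rw [Real.norm_eq_abs, abs_of_nonneg (potential_nonneg hε)]
  exact potential_le hβ0 hε _

/-- The truncated potential drops by `β / 2` at each application of the left branch, for points
beyond the scale `ε`. -/
lemma potential_leftMap_le {a β ε x : ℝ} (ha : 0 < a) (haβ : a ≤ β) (hβ1 : β < 1)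
    (hε : 0 < ε) (hx : x ∈ Set.Ioo (0 : ℝ) (1 / 2)) :
    potential β ε (leftMap a x) ≤
      potential β ε x - β / 2 + (Set.Ioc 0 ε).indicator (fun _ => β / 2) x := by
  have hβ0 := ha.trans_le haβ
  have hx0 := hx.1
  by_cases hxε : x ≤ ε
  · rw [Set.indicator_of_mem (Set.mem_Ioc.2 ⟨hx0, hxε⟩), sub_add_cancel]
    have : x ≤ leftMap a x := by
      have := sub_le_leftMap_sub ha le_rfl hx0.le
      rw [leftMap_zero] at this; linarith
    exact Real.rpow_le_rpow_of_nonpos (hε.trans_le (le_max_right _ _))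
      (max_le_max_right _ this) (by linarith)
  · rw [Set.indicator_of_notMem (fun h => hxε h.2), add_zero]
    push Not at hxε
    have h1 := two_mul_rpow_le_one ha ⟨hx0, hx.2.le⟩
    have h2 := two_mul_rpow_anti haβ ⟨hx0, hx.2.le⟩
    have hV : potential β ε x = x ^ (-β) := by rw [potential, max_eq_left hxε.le]
    have hT0 : 0 < leftMap a x := by unfold leftMap; positivity
    refine (potential_le_rpow hβ0 hT0).trans ?_
    rw [hV]
    unfold leftMap
    set ξ := (2 : ℝ) ^ a * x ^ a with hξ
    have hξ0 : 0 < ξ := by positivity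
    rw [Real.mul_rpow hx0.le (by linarith)]
    -- `(1 + ξ) ^ (-β) = (1 - ξ / (1 + ξ)) ^ β ≤ 1 - β ξ / 2`
    have hb : (1 + ξ) ^ (-β) ≤ 1 - β * (ξ / 2) := by
      have e1 : (1 + ξ) ^ (-β) = (1 + -(ξ / (1 + ξ))) ^ β := by
        rw [Real.rpow_neg (by linarith), ← Real.inv_rpow (by linarith)]
        congr 1; field_simp; ring
      have e2 : ξ / 2 ≤ ξ / (1 + ξ) := by gcongr; linarith
      have e3 : ξ / (1 + ξ) ≤ 1 := by rw [div_le_one (by linarith)]; linarith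
      rw [e1]
      refine (rpow_one_add_le_one_add_mul_self (by linarith) hβ0.le hβ1.le).trans ?_
      nlinarith
    have h2β : (1 : ℝ) ≤ 2 ^ β := Real.one_le_rpow one_le_two hβ0.le
    have hxβ : 0 < x ^ β := Real.rpow_pos_of_pos hx0 _
    have hinv : x ^ (-β) * x ^ β = 1 := by
      rw [Real.rpow_neg hx0.le]; exact inv_mul_cancel₀ hxβ.ne'
    have hneg : 0 < x ^ (-β) := Real.rpow_pos_of_pos hx0 _
    have h3 : 1 ≤ x ^ (-β) * ξ := by
      rw [← hinv]; gcongr; nlinarith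
    nlinarith [mul_le_mul_of_nonneg_left hb hneg.le]

/-- One step of the drift inequality: mass located in `[ε, 1/2)` decreases the potential, and
the mass which re-enters near the fixed point is controlled by the value of the new density at
`1`. -/
lemma integral_potential_transfer_le {a β ε : ℝ} (ha : 0 < a) (haβ : a ≤ β) (hβ1 : β < 1)
    (hε : ε ∈ Set.Ioc (0 : ℝ) 1) {g : ℝ → ℝ} (hi : Integrable g leb)
    (h : ∀ x ∈ Set.Ioc (0 : ℝ) 1, 0 ≤ g x) (hg : AntitoneOn g (Set.Ioc 0 1)) :
    ∫ x, potential β ε x * transfer a g x ∂leb ≤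
      ∫ x, potential β ε x * g x ∂leb
        - β / 2 * (∫ x, g x ∂leb - ∫ x in Set.Ioc 0 ε, g x ∂leb)
        + 3 / (2 * (1 - β)) * transfer a g 1 := by
  have hβ0 := ha.trans_le haβ
  have h1 : (1 : ℝ) ∈ Set.Ioc (0 : ℝ) 1 := by norm_num
  have hhalf : g (1 / 2) / 3 ≤ transfer a g 1 :=
    third_le_transfer ha (haβ.trans hβ1.le) h hg (by norm_num) h1 (leftInv_one ha).le
  -- the new density is split into the contributions of the two branches
  have hiL : Integrable (fun x => potential β ε x *
      (g (leftInv a x) / slope a (leftInv a x))) leb := by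
    have := integrableOn_leftBranch ha (integrable_iff_halves hi).1
    rw [leb_eq_Ioo]
    exact integrable_potential_mul hβ0 hε.1 measurable_id this
  have hiV : Integrable (fun x => potential β ε x) leb := by
    simpa using integrable_potential_mul hβ0 hε.1 measurable_id (integrable_const (1 : ℝ))
      (ν := leb)
  have hV : ∫ x, potential β ε x ∂leb ≤ 1 / (1 - β) := by
    have e := setIntegral_rpow_neg (t := 1) hβ1 (by norm_num)
    rw [Real.one_rpow] at e
    rw [← e, leb_eq_Ioc, Measure.restrict_restrict measurableSet_Ioc, Set.inter_self, ← leb_eq_Ioc]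
    exact integral_leb_mono hiV (integrable_rpow_neg hβ1)
      fun x hx => potential_le_rpow hβ0 hx.1
  have hsplit : ∫ x, potential β ε x * transfer a g x ∂leb ≤
      ∫ x, potential β ε x * (g (leftInv a x) / slope a (leftInv a x)) ∂leb +
        g (1 / 2) / 2 * ∫ x, potential β ε x ∂leb := by
    rw [← integral_const_mul, ← integral_add hiL (hiV.const_mul _)]
    refine integral_leb_mono (integrable_potential_mul hβ0 hε.1 measurable_id
      (integrable_transfer ha hi)) (hiL.add (hiV.const_mul _)) fun x hx => ?_
    have e1 := hg (show (1 / 2 : ℝ) ∈ Set.Ioc (0 : ℝ) 1 by norm_num) (rightInv_mem_unit hx)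
      (by linarith [hx.1])
    have e2 := potential_nonneg (β := β) (x := x) hε.1
    unfold transfer
    nlinarith
  have hleft : ∫ x, potential β ε x * (g (leftInv a x) / slope a (leftInv a x)) ∂leb =
      ∫ x in Set.Ioo 0 (1 / 2), potential β ε (leftMap a x) * g x := by
    rw [← integral_leftBranch ha (fun x => potential β ε (leftMap a x) * g x), leb_eq_Ioo]
    refine setIntegral_congr_fun measurableSet_Ioo fun x hx => ?_
    rw [leftMap_leftInv ha (Set.Ioo_subset_Icc_self hx)]; ring
  set G : ℝ → ℝ := fun x => potential β ε x * g x - β / 2 * g x +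
    β / 2 * (Set.Ioc 0 ε).indicator g x with hG
  have hiVg : Integrable (fun x => potential β ε x * g x) leb :=
    integrable_potential_mul hβ0 hε.1 measurable_id hi
  have hiVg' : Integrable (fun x => potential β ε x * g x - β / 2 * g x) leb :=
    hiVg.sub (hi.const_mul _)
  have hiI : Integrable ((Set.Ioc 0 ε).indicator g) leb := hi.indicator measurableSet_Ioc
  have hiG : Integrable G leb := hiVg'.add (hiI.const_mul _)
  have hGle : ∫ x in Set.Ioo 0 (1 / 2), potential β ε (leftMap a x) * g x ≤ ∫ x, G x ∂leb := by
    rw [integral_leb_eq_halves hiG]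
    have e1 : ∫ x in Set.Ioo 0 (1 / 2), potential β ε (leftMap a x) * g x ≤
        ∫ x in Set.Ioo 0 (1 / 2), G x := by
      refine setIntegral_mono_on (integrable_potential_mul hβ0 hε.1
        (continuous_leftMap ha).measurable (integrable_iff_halves hi).1)
        (integrable_iff_halves hiG).1 measurableSet_Ioo fun x hx => ?_
      have e2 := potential_leftMap_le ha haβ hβ1 hε.1 hx
      have e3 := mul_le_mul_of_nonneg_right e2 (h x ⟨hx.1, by linarith [hx.2]⟩)
      refine e3.trans (le_of_eq ?_)
      simp only [hG]
      by_cases hm : x ∈ Set.Ioc 0 ε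
      · rw [Set.indicator_of_mem hm, Set.indicator_of_mem hm]; ring
      · rw [Set.indicator_of_notMem hm, Set.indicator_of_notMem hm]; ring
    have e4 : 0 ≤ ∫ x in Set.Ioo (1 / 2) 1, G x := by
      refine setIntegral_nonneg measurableSet_Ioo fun x hx => ?_
      have hx' : x ∈ Set.Ioc (0 : ℝ) 1 := ⟨by linarith [hx.1], hx.2.le⟩
      have e5 := one_le_potential hβ0 hε hx.2.le
      have e6 := h x hx'
      have e7 : 0 ≤ (Set.Ioc 0 ε).indicator g x := by
        by_cases hm : x ∈ Set.Ioc 0 ε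
        · rw [Set.indicator_of_mem hm]; exact e6
        · rw [Set.indicator_of_notMem hm]
      have e8 : 0 ≤ (potential β ε x - β / 2) * g x := mul_nonneg (by linarith) e6
      simp only [hG]
      nlinarith
    linarith
  have hGint : ∫ x, G x ∂leb = ∫ x, potential β ε x * g x ∂leb
        - β / 2 * (∫ x, g x ∂leb - ∫ x in Set.Ioc 0 ε, g x ∂leb) := by
    simp only [hG]
    rw [integral_add hiVg' (hiI.const_mul _),
      integral_sub hiVg (hi.const_mul _), integral_const_mul, integral_const_mul,
      integral_indicator measurableSet_Ioc]
    ring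
  have hlast : g (1 / 2) / 2 * ∫ x, potential β ε x ∂leb ≤
      3 / (2 * (1 - β)) * transfer a g 1 := by
    have e1 := h (1 / 2) (by norm_num)
    have e2 : 0 < 1 - β := by linarith
    calc g (1 / 2) / 2 * ∫ x, potential β ε x ∂leb
        ≤ (3 * transfer a g 1) / 2 * (1 / (1 - β)) := by
          gcongr
          · exact integral_nonneg fun x => potential_nonneg hε.1
          · linarith
          · linarith
      _ = _ := by field_simp
  linarith

lemma DecDensity.sub_const {β M c : ℝ} {g : ℝ → ℝ} (hg : DecDensity β M g) (hc : 0 ≤ c)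
    (hcg : ∀ x ∈ Set.Ioc (0 : ℝ) 1, c ≤ g x) : DecDensity β M fun x => g x - c where
  integrable := hg.integrable.sub (integrable_const _)
  nonneg x hx := sub_nonneg.2 (hcg x hx)
  anti _ hx _ hy hxy := sub_le_sub_right (hg.anti hx hy hxy) c
  le_rpow x hx := (sub_le_self _ hc).trans (hg.le_rpow x hx)
  mass_le := (integral_leb_mono (hg.integrable.sub (integrable_const _)) hg.integrable
    fun _ _ => sub_le_self _ hc).trans hg.mass_le

lemma integral_sub_const {g : ℝ → ℝ} (hg : Integrable g leb) (c : ℝ) :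
    ∫ x, (g x - c) ∂leb = ∫ x, g x ∂leb - c := by
  rw [integral_sub hg (integrable_const _)]; simp

/-- At each step the minimum of the density, which is its value at `1`, is removed. A removed
constant `c` contributes at least `γ c` to the final density, and the drift inequality shows that
the total removed mass `r` is large after sufficiently many steps. -/
lemma exists_removed_mass {β γ ε M : ℝ} (hβ0 : 0 < β) (hβ1 : β < 1) (hε : ε ∈ Set.Ioc (0 : ℝ) 1)
    (hγ : ∀ α : ℕ → ℝ, Admissible β α → ∀ n : ℕ,
      ∀ x ∈ Set.Ioc (0 : ℝ) 1, γ ≤ transferIter α n (fun _ => 1) x) (N : ℕ) :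
    ∀ (α : ℕ → ℝ), Admissible β α → ∀ g : ℝ → ℝ, DecDensity β M g →
      ∃ r : ℝ, 0 ≤ r ∧ (∀ x ∈ Set.Ioc (0 : ℝ) 1, γ * r ≤ transferIter α N g x) ∧
        β / 2 * N * (∫ x, g x ∂leb - r - coneConst β * M * (ε ^ (1 - β) / (1 - β))) ≤
          ∫ x, potential β ε x * g x ∂leb + 3 / (2 * (1 - β)) * r := by
  induction N with
  | zero =>
    intro α hα g hg
    refine ⟨0, le_rfl, fun x hx => ?_, ?_⟩
    · rw [mul_zero]; exact hg.nonneg x hx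
    · simpa using integral_leb_nonneg fun x hx =>
        mul_nonneg (potential_nonneg hε.1) (hg.nonneg x hx)
  | succ N ih =>
    intro α hα g hg
    have ha := hα.pos 0
    have haβ := (hα 1 le_rfl).2
    have h1 : (1 : ℝ) ∈ Set.Ioc (0 : ℝ) 1 := by norm_num
    have hP := hg.transfer ha haβ hβ1
    set c := transfer (α 1) g 1 with hc
    have hc0 : 0 ≤ c := hP.nonneg 1 h1
    have hcg : ∀ x ∈ Set.Ioc (0 : ℝ) 1, c ≤ transfer (α 1) g x :=
      fun x hx => hP.anti hx h1 hx.2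
    have hg1 := hP.sub_const hc0 hcg
    obtain ⟨r, hr0, hr, hineq⟩ := ih _ (hα.shift 1) _ hg1
    refine ⟨r + c, by linarith, fun x hx => ?_, ?_⟩
    · have hdec : transfer (α 1) g = fun x => (transfer (α 1) g x - c) + c * 1 := by
        ext x; ring
      rw [transferIter_succ', hdec, transferIter_add_mul, mul_add, mul_comm γ c]
      exact add_le_add (hr x hx) (mul_le_mul_of_nonneg_left (hγ _ (hα.shift 1) N x hx) hc0)
    · rw [integral_sub_const hP.integrable, integral_transfer ha hg.integrable] at hineq
      have hstep := integral_potential_transfer_le ha haβ hβ1 hε hg.integrable hg.nonneg hg.anti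
      have hE : ∫ x, potential β ε x * (transfer (α 1) g x - c) ∂leb ≤
          ∫ x, potential β ε x * transfer (α 1) g x ∂leb := by
        refine integral_leb_mono (integrable_potential_mul hβ0 hε.1 measurable_id hg1.integrable)
          (integrable_potential_mul hβ0 hε.1 measurable_id hP.integrable) fun x hx => ?_
        exact mul_le_mul_of_nonneg_left (sub_le_self _ hc0) (potential_nonneg hε.1)
      have he := hg.setIntegral_Ioc_le hβ1 hε
      push_cast
      nlinarith

/-- After a time of order `(M / s) ^ (β / (1 - β))`, a density of mass `s` is bounded below by a
fixed multiple of `s`. -/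
lemma exists_le_transferIter {β : ℝ} (hβ0 : 0 < β) (hβ1 : β < 1) :
    ∃ γ B : ℝ, 0 < γ ∧ γ < 1 ∧ 0 < B ∧ ∀ α : ℕ → ℝ, Admissible β α →
      ∀ (M : ℝ) (g : ℝ → ℝ), DecDensity β M g → 0 < ∫ x, g x ∂leb → ∀ N : ℕ,
      B * (M / ∫ x, g x ∂leb) ^ (β / (1 - β)) ≤ N →
      ∀ x ∈ Set.Ioc (0 : ℝ) 1, γ * ∫ x, g x ∂leb ≤ transferIter α N g x := by
  obtain ⟨γ, hγ0, hγ1, hγ⟩ := exists_le_transferIter_one hβ0 hβ1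
  have hA := coneConst_ge hβ0 hβ1
  have h1β : 0 < 1 - β := by linarith
  set D := 3 / (2 * (1 - β)) with hD
  have hD0 : 0 < D := by positivity
  set K := 4 * coneConst β / (1 - β) with hK
  have hK1 : 1 ≤ K := by rw [hK, one_le_div h1β]; linarith
  refine ⟨γ / 2, 8 / β * (1 + D) * K ^ (β / (1 - β)), by positivity, by linarith,
    by positivity, fun α hα M g hg hs N hN x hx => ?_⟩
  have hsM := hg.mass_le
  set s := ∫ x, g x ∂leb with hsdef
  have hM0 : 0 < M := hs.trans_le hsM
  -- the scale `ε` is chosen so that the mass below it is at most `s / 4`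
  set q := K * (M / s) with hq
  have hMs : 1 ≤ M / s := (one_le_div hs).2 hsM
  have hq1 : 1 ≤ q := by nlinarith
  have hq0 : 0 < q := by linarith
  set ε := q ^ (-(1 / (1 - β))) with hεdef
  have hε : ε ∈ Set.Ioc (0 : ℝ) 1 :=
    ⟨Real.rpow_pos_of_pos hq0 _,
      Real.rpow_le_one_of_one_le_of_nonpos hq1 (neg_nonpos.2 (by positivity))⟩
  have hεpow : ε ^ (1 - β) = q⁻¹ := by
    rw [hεdef, ← Real.rpow_mul hq0.le, neg_mul, one_div_mul_cancel h1β.ne', Real.rpow_neg_one]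
  have hεneg : ε ^ (-β) = K ^ (β / (1 - β)) * (M / s) ^ (β / (1 - β)) := by
    rw [hεdef, ← Real.rpow_mul hq0.le, ← Real.mul_rpow (by linarith) (by linarith)]
    congr 1; field_simp
  have he : coneConst β * M * (ε ^ (1 - β) / (1 - β)) = s / 4 := by
    have : coneConst β ≠ 0 := by linarith
    rw [hεpow, hq, hK]; field_simp
  obtain ⟨r, hr0, hr, hineq⟩ := exists_removed_mass hβ0 hβ1 hε hγ N α hα g hg
  rw [he, ← hsdef] at hineq
  have hE : ∫ x, potential β ε x * g x ∂leb ≤ ε ^ (-β) * s := by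
    rw [hsdef, ← integral_const_mul]
    refine integral_leb_mono (integrable_potential_mul hβ0 hε.1 measurable_id hg.integrable)
      (hg.integrable.const_mul _) fun x hx => ?_
    exact mul_le_mul_of_nonneg_right (potential_le hβ0 hε.1 x) (hg.nonneg x hx)
  have hN' : 8 / β * (1 + D) * ε ^ (-β) ≤ N := by
    rw [hεneg, ← mul_assoc]; exact hN
  have hε1 := one_le_rpow_neg hβ0 hε
  have hN2 : 4 * (1 + D) * ε ^ (-β) ≤ β / 2 * N := by
    calc 4 * (1 + D) * ε ^ (-β) = β / 2 * (8 / β * (1 + D) * ε ^ (-β)) := by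
          field_simp; norm_num
      _ ≤ _ := by gcongr
  have hr2 : s / 2 ≤ r := by
    by_contra hlt
    push Not at hlt
    have e1 : β / 2 * N * (s / 4) < β / 2 * N * (s - r - s / 4) := by
      have : 0 < β / 2 * N := lt_of_lt_of_le (by positivity) hN2
      gcongr
      linarith
    have e2 : (1 + D) * ε ^ (-β) * s ≤ β / 2 * N * (s / 4) := by
      nlinarith
    have e3 : D * r ≤ D * (ε ^ (-β) * s) := by
      gcongr; nlinarith
    nlinarith
  refine le_trans ?_ (hr x hx)
  nlinarith

/-! ### Loss of memory -/

lemma DecDensity.nonneg_bound {β M : ℝ} {g : ℝ → ℝ} (hg : DecDensity β M g) : 0 ≤ M :=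
  (integral_leb_nonneg hg.nonneg).trans hg.mass_le

/-- If the common mass of `u` and `v` is still above the target, both images are at least
`γ` times that mass, and this common constant is removed from both of them. Otherwise nothing has
to be removed. -/
lemma exists_coupling_step {β γ B q M : ℝ} (hβ0 : 0 < β) (hβ1 : β < 1) (hγ1 : γ < 1)
    (hγ0 : 0 < γ) (hB : 0 < B)
    (hmin : ∀ α : ℕ → ℝ, Admissible β α → ∀ (M : ℝ) (g : ℝ → ℝ), DecDensity β M g →
      0 < ∫ x, g x ∂leb → ∀ N : ℕ, B * (M / ∫ x, g x ∂leb) ^ (β / (1 - β)) ≤ N →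
      ∀ x ∈ Set.Ioc (0 : ℝ) 1, γ * ∫ x, g x ∂leb ≤ transferIter α N g x)
    {α : ℕ → ℝ} (hα : Admissible β α) {u v : ℝ → ℝ} (hu : DecDensity β M u)
    (hv : DecDensity β M v) (huv : ∫ x, u x ∂leb = ∫ x, v x ∂leb)
    (hq : 0 < q) (hle : ∫ x, u x ∂leb ≤ q * M) {N : ℕ}
    (hN : B * (((1 - γ) * q) ^ (-(β / (1 - β)))) ≤ N) :
    ∃ u' v' : ℝ → ℝ, DecDensity β M u' ∧ DecDensity β M v' ∧
      ∫ x, u' x ∂leb = ∫ x, v' x ∂leb ∧ ∫ x, u' x ∂leb ≤ (1 - γ) * q * M ∧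
      ∀ x, transferIter α N u x - transferIter α N v x = u' x - v' x := by
  have hM := hu.nonneg_bound
  have hu' := hu.transferIter hα hβ1 N
  have hv' := hv.transferIter hα hβ1 N
  have iu := integral_transferIter hα hu.integrable N
  have iv := integral_transferIter hα hv.integrable N
  have hθ : 0 < β / (1 - β) := div_pos hβ0 (by linarith)
  have hq1 : 0 < (1 - γ) * q := mul_pos (by linarith) hq
  rcases le_or_gt (∫ x, u x ∂leb) ((1 - γ) * q * M) with h | h
  · exact ⟨_, _, hu', hv', by rw [iu, iv, huv], by rwa [iu], fun x => rfl⟩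
  · have hs : 0 < ∫ x, u x ∂leb := lt_of_le_of_lt (by positivity) h
    have hN' : B * (M / ∫ x, u x ∂leb) ^ (β / (1 - β)) ≤ N := by
      refine le_trans ?_ hN
      rw [Real.rpow_neg hq1.le, ← Real.inv_rpow hq1.le]
      have : M / ∫ x, u x ∂leb ≤ ((1 - γ) * q)⁻¹ := by
        rw [div_le_iff₀ hs, le_inv_mul_iff₀ hq1]; exact h.le
      gcongr
    have hmu := hmin α hα M u hu hs N hN'
    have hmv := hmin α hα M v hv (huv ▸ hs) N (huv ▸ hN')
    rw [← huv] at hmv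
    have hc : 0 ≤ γ * ∫ x, u x ∂leb := by positivity
    refine ⟨_, _, hu'.sub_const hc hmu, hv'.sub_const hc hmv, ?_, ?_, fun x => by ring⟩
    · rw [integral_sub_const hu'.integrable, integral_sub_const hv'.integrable, iu, iv, huv]
    · rw [integral_sub_const hu'.integrable, iu]
      nlinarith

/-- After the first `j` stages, of lengths `N 0, …, N (j - 1)`, the parts of `u` and `v` which have
not been cancelled have mass at most `(1 - γ) ^ j * M`. -/
lemma exists_coupling {β γ B M : ℝ} (hβ0 : 0 < β) (hβ1 : β < 1) (hγ1 : γ < 1)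
    (hγ0 : 0 < γ) (hB : 0 < B)
    (hmin : ∀ α : ℕ → ℝ, Admissible β α → ∀ (M : ℝ) (g : ℝ → ℝ), DecDensity β M g →
      0 < ∫ x, g x ∂leb → ∀ N : ℕ, B * (M / ∫ x, g x ∂leb) ^ (β / (1 - β)) ≤ N →
      ∀ x ∈ Set.Ioc (0 : ℝ) 1, γ * ∫ x, g x ∂leb ≤ transferIter α N g x)
    {α : ℕ → ℝ} (hα : Admissible β α) {u v : ℝ → ℝ} (hu : DecDensity β M u)
    (hv : DecDensity β M v) (huv : ∫ x, u x ∂leb = ∫ x, v x ∂leb) (N : ℕ → ℕ)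
    (hN : ∀ j, B * (((1 - γ) ^ (j + 1)) ^ (-(β / (1 - β)))) ≤ N j) (j : ℕ) :
    ∃ u' v' : ℝ → ℝ, DecDensity β M u' ∧ DecDensity β M v' ∧
      ∫ x, u' x ∂leb = ∫ x, v' x ∂leb ∧ ∫ x, u' x ∂leb ≤ (1 - γ) ^ j * M ∧
      ∀ x ∈ Set.Ioc (0 : ℝ) 1, transferIter α (∑ i ∈ Finset.range j, N i) u x -
        transferIter α (∑ i ∈ Finset.range j, N i) v x = u' x - v' x := by
  induction j with
  | zero => exact ⟨u, v, hu, hv, huv, by simpa using hu.mass_le, fun x _ => rfl⟩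
  | succ j ih =>
    obtain ⟨u₁, v₁, hu₁, hv₁, he₁, hm₁, h₁⟩ := ih
    have hNj := hN j
    rw [pow_succ'] at hNj
    set t := ∑ i ∈ Finset.range j, N i with ht
    obtain ⟨u₂, v₂, hu₂, hv₂, he₂, hm₂, h₂⟩ := exists_coupling_step hβ0 hβ1 hγ1 hγ0 hB hmin
      (hα.shift t) hu₁ hv₁ he₁ (pow_pos (by linarith) j) hm₁ hNj
    refine ⟨u₂, v₂, hu₂, hv₂, he₂, by rw [pow_succ']; exact hm₂, fun x hx => ?_⟩
    rw [Finset.sum_range_succ, ← ht, transferIter_add, transferIter_add, ← h₂ x]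
    have e := transferIter_congr (hα.shift t) h₁ (N j) hx
    rwa [transferIter_sub, transferIter_sub] at e

lemma sum_ceil_le {B R : ℝ} (hB : 0 < B) (hR : 1 < R) (j : ℕ) :
    ((∑ i ∈ Finset.range j, ⌈B * R ^ (i + 1)⌉₊ : ℕ) : ℝ) ≤ (B + 1) * R / (R - 1) * R ^ j := by
  have hR0 : 0 < R - 1 := by linarith
  push_cast
  calc ∑ i ∈ Finset.range j, (⌈B * R ^ (i + 1)⌉₊ : ℝ)
      ≤ ∑ i ∈ Finset.range j, (B + 1) * R * R ^ i := by
        refine Finset.sum_le_sum fun i _ => ?_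
        have h1 := (Nat.ceil_lt_add_one (a := B * R ^ (i + 1)) (by positivity)).le
        have h2 : 1 ≤ R ^ (i + 1) := one_le_pow₀ hR.le
        calc (⌈B * R ^ (i + 1)⌉₊ : ℝ) ≤ B * R ^ (i + 1) + 1 := h1
          _ ≤ B * R ^ (i + 1) + R ^ (i + 1) := by linarith
          _ = _ := by ring
    _ = (B + 1) * R * ((R ^ j - 1) / (R - 1)) := by
        rw [← Finset.mul_sum, geom_sum_eq hR.ne']
    _ ≤ (B + 1) * R * (R ^ j / (R - 1)) := by gcongr; linarith
    _ = _ := by ring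

lemma integral_abs_transferIter_sub_le {β : ℝ} {α : ℕ → ℝ} (hα : Admissible β α)
    {u v : ℝ → ℝ} (hu : Integrable u leb) (hv : Integrable v leb)
    (hu0 : ∀ x ∈ Set.Ioc (0 : ℝ) 1, 0 ≤ u x) (hv0 : ∀ x ∈ Set.Ioc (0 : ℝ) 1, 0 ≤ v x) (n : ℕ) :
    ∫ x, |transferIter α n u x - transferIter α n v x| ∂leb ≤
      ∫ x, u x ∂leb + ∫ x, v x ∂leb := by
  have iu := integrable_transferIter hα hu n
  have iv := integrable_transferIter hα hv n
  rw [← integral_transferIter hα hu n, ← integral_transferIter hα hv n, ← integral_add iu iv]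
  refine integral_leb_mono (iu.sub iv).abs (iu.add iv) fun x hx => ?_
  have h1 := transferIter_nonneg hα hu0 n x hx
  have h2 := transferIter_nonneg hα hv0 n x hx
  exact abs_sub_le_iff.2 ⟨by linarith, by linarith⟩

/-- Polynomial loss of memory for decreasing densities. The lengths of the stages grow like
`R ^ j` while the masses decay like `q ^ j = (R ^ j) ^ (-(1 - β) / β)`; the whole time is dominated
by the last stage, which gives the rate without a logarithm. -/
lemma exists_memory_loss {β : ℝ} (hβ0 : 0 < β) (hβ1 : β < 1) :
    ∃ C : ℝ, 0 < C ∧ ∀ α : ℕ → ℝ, Admissible β α → ∀ (M : ℝ) (u v : ℝ → ℝ),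
      DecDensity β M u → DecDensity β M v → ∫ x, u x ∂leb = ∫ x, v x ∂leb → ∀ n : ℕ, 1 ≤ n →
      ∫ x, |transferIter α n u x - transferIter α n v x| ∂leb ≤
        C * M * (n : ℝ) ^ (-(1 / β) + 1) := by
  obtain ⟨γ, B, hγ0, hγ1, hB, hmin⟩ := exists_le_transferIter hβ0 hβ1
  have h1β : 0 < 1 - β := by linarith
  set θ := β / (1 - β) with hθdef
  have hθ : 0 < θ := div_pos hβ0 h1β
  set q := 1 - γ with hqdef
  have hq0 : 0 < q := by linarith
  have hq1 : q < 1 := by linarith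
  set R := q ^ (-θ) with hRdef
  have hR : 1 < R := Real.one_lt_rpow_of_pos_of_lt_one_of_neg hq0 hq1 (by linarith)
  set K := (B + 1) * R / (R - 1) with hK
  have hR0 : 0 < R - 1 := by linarith
  have hK0 : 0 < K := by positivity
  have hKR : 0 < K * R := by positivity
  have hpow : ∀ j : ℕ, (q ^ j) ^ (-θ) = R ^ j := fun j => by
    rw [hRdef, ← Real.rpow_natCast, ← Real.rpow_natCast, ← Real.rpow_mul hq0.le,
      ← Real.rpow_mul hq0.le, mul_comm]
  have hκ : -(1 / β) + 1 = -θ⁻¹ := by rw [hθdef]; field_simp; ring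
  refine ⟨2 * (K * R) ^ θ⁻¹, by positivity, fun α hα M u v hu hv huv n hn => ?_⟩
  have hM := hu.nonneg_bound
  have hn0 : (0 : ℝ) < n := by exact_mod_cast hn
  have hrate : ∀ j : ℕ, (n : ℝ) < K * R ^ (j + 1) →
      q ^ j ≤ (K * R) ^ θ⁻¹ * (n : ℝ) ^ (-(1 / β) + 1) := by
    intro j hj
    have h1 : R ^ j = (q ^ j) ^ (-θ) := (hpow j).symm
    have h2 : q ^ j = (R ^ j) ^ (-θ⁻¹) := by
      rw [h1, ← Real.rpow_mul (by positivity), neg_mul_neg, mul_inv_cancel₀ hθ.ne', Real.rpow_one]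
    rw [h2, hκ, Real.rpow_neg (by positivity), Real.rpow_neg hn0.le,
      ← Real.inv_rpow (by positivity), ← Real.inv_rpow hn0.le,
      ← Real.mul_rpow hKR.le (by positivity)]
    have : (R ^ j)⁻¹ ≤ K * R * (n : ℝ)⁻¹ := by
      rw [← div_eq_mul_inv, le_div_iff₀ hn0, inv_mul_le_iff₀ (by positivity)]
      calc (n : ℝ) ≤ K * R ^ (j + 1) := hj.le
        _ = _ := by ring
    gcongr
  -- `K * R ^ j` steps leave uncancelled mass `q ^ j * M`, so it suffices that `n` is at most `R`
  -- times this number of steps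
  suffices h : ∃ j : ℕ, (n : ℝ) < K * R ^ (j + 1) ∧
      ∫ x, |transferIter α n u x - transferIter α n v x| ∂leb ≤ 2 * (q ^ j * M) by
    obtain ⟨j, hj, hle⟩ := h
    refine hle.trans ?_
    calc 2 * (q ^ j * M) ≤ 2 * ((K * R) ^ θ⁻¹ * (n : ℝ) ^ (-(1 / β) + 1) * M) := by
          gcongr; exact hrate j hj
      _ = _ := by ring
  rcases lt_or_ge (n : ℝ) K with hnK | hnK
  · refine ⟨0, hnK.trans (by rw [zero_add, pow_one]; nlinarith), ?_⟩
    have := integral_abs_transferIter_sub_le hα hu.integrable hv.integrable hu.nonneg hv.nonneg n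
    rw [← huv] at this
    linarith [hu.mass_le]
  · obtain ⟨j, hj1, hj2⟩ := exists_nat_pow_near ((one_le_div hK0).2 hnK) hR
    rw [le_div_iff₀ hK0] at hj1
    rw [div_lt_iff₀ hK0] at hj2
    refine ⟨j, by linarith, ?_⟩
    set N : ℕ → ℕ := fun i => ⌈B * R ^ (i + 1)⌉₊ with hN
    obtain ⟨u', v', hu', hv', he, hm, h⟩ := exists_coupling hβ0 hβ1 hγ1 hγ0 hB hmin hα hu hv huv N
      (fun i => by rw [hpow]; exact Nat.le_ceil _) j
    have ht : ∑ i ∈ Finset.range j, N i ≤ n := by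
      have h2 : ((∑ i ∈ Finset.range j, N i : ℕ) : ℝ) ≤ n :=
        (sum_ceil_le hB hR j).trans (by rw [← hK]; linarith)
      exact_mod_cast h2
    set t := ∑ i ∈ Finset.range j, N i
    obtain ⟨m, rfl⟩ := Nat.exists_eq_add_of_le ht
    have heq : ∫ x, |transferIter α (t + m) u x - transferIter α (t + m) v x| ∂leb =
        ∫ x, |transferIter (fun i => α (t + i)) m u' x -
          transferIter (fun i => α (t + i)) m v' x| ∂leb := by
      refine integral_congr_ae (ae_leb_Ioc.mono fun x hx => ?_)
      have e := transferIter_congr (hα.shift t) h m hx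
      rw [transferIter_sub, transferIter_sub] at e
      simp only [transferIter_add, e]
    rw [heq]
    have := integral_abs_transferIter_sub_le (hα.shift t) hu'.integrable hv'.integrable
      hu'.nonneg hv'.nonneg m
    rw [← he] at this
    linarith

lemma rpow_le_rho {β : ℝ} (hβ0 : 0 < β) {n : ℕ} (hn : 2 ≤ n) :
    (n : ℝ) ^ (-(1 / β) + 1) ≤ (Real.log 2 ^ (1 / β))⁻¹ * rho β n := by
  have h2 : (0 : ℝ) < Real.log 2 := Real.log_pos one_lt_two
  have hn0 : (2 : ℝ) ≤ n := by exact_mod_cast hn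
  have h3 : 0 < Real.log 2 ^ (1 / β) := Real.rpow_pos_of_pos h2 _
  rw [rho, if_neg (by omega), le_inv_mul_iff₀ h3, mul_comm]
  gcongr

lemma exists_memory_loss_rho {β : ℝ} (hβ0 : 0 < β) (hβ1 : β < 1) :
    ∃ C : ℝ, 0 < C ∧ ∀ α : ℕ → ℝ, Admissible β α → ∀ (M : ℝ) (u v : ℝ → ℝ),
      DecDensity β M u → DecDensity β M v → ∫ x, u x ∂leb = ∫ x, v x ∂leb → ∀ n : ℕ,
      ∫ x, |transferIter α n u x - transferIter α n v x| ∂leb ≤ C * M * rho β n := by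
  obtain ⟨C, hC, h⟩ := exists_memory_loss hβ0 hβ1
  have h2 : 0 < Real.log 2 ^ (1 / β) := Real.rpow_pos_of_pos (Real.log_pos one_lt_two) _
  refine ⟨C * (Real.log 2 ^ (1 / β))⁻¹ + 2, by positivity, fun α hα M u v hu hv huv n => ?_⟩
  have hM := hu.nonneg_bound
  rcases lt_or_ge n 2 with hn | hn
  · have h1 := integral_abs_transferIter_sub_le hα hu.integrable hv.integrable hu.nonneg
      hv.nonneg n
    rw [← huv] at h1
    rw [rho, if_pos hn, mul_one]
    have : 0 ≤ C * (Real.log 2 ^ (1 / β))⁻¹ * M := by positivity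
    linarith [hu.mass_le]
  · refine (h α hα M u v hu hv huv n (by omega)).trans ?_
    have h3 := rpow_le_rho hβ0 hn
    have h4 : 0 ≤ rho β n := by
      rw [rho, if_neg (by omega)]
      have : 0 ≤ Real.log n := Real.log_natCast_nonneg n
      positivity
    calc C * M * (n : ℝ) ^ (-(1 / β) + 1)
        ≤ C * M * ((Real.log 2 ^ (1 / β))⁻¹ * rho β n) := by gcongr
      _ ≤ (C * (Real.log 2 ^ (1 / β))⁻¹ + 2) * M * rho β n := by
          nlinarith [mul_nonneg hM h4]

/-! ### Lipschitz multiples of decreasing densities -/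

/-- The function `ψ` behaves like a sum of products `w * v`, where the `v` are decreasing and
nonnegative with sum `u`, and each `w` is bounded by `S` and has Lipschitz constant `K`. The pair
of inequalities replaces the sum over the inverse branches of a composition, and it is preserved by
transfer operators without any loss in `S` and `K`. -/
structure Dominated (S K : ℝ) (u ψ : ℝ → ℝ) : Prop where
  bound : ∀ x ∈ Set.Ioc (0 : ℝ) 1, |ψ x| ≤ S * u x
  variation : ∀ x ∈ Set.Ioc (0 : ℝ) 1, ∀ y ∈ Set.Ioc (0 : ℝ) 1, x ≤ y →
    |ψ y - ψ x| ≤ S * (u x - u y) + K * (y - x) * u x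

/-- The contribution of one inverse branch: `p` and `p'` are its derivatives at two points at
distance `d'` whose images are at distance `d`. -/
lemma abs_weighted_sub_le {S K p p' u u' ψ ψ' d d' : ℝ} (hK : 0 ≤ K) (hu : 0 ≤ u)
    (hp' : 0 ≤ p') (hpp : p' ≤ p) (hd : d ≤ d') (hd0 : 0 ≤ d) (hψ : |ψ| ≤ S * u)
    (h : |ψ' - ψ| ≤ S * (u - u') + K * d * u) :
    |ψ' * p' - ψ * p| ≤ S * (u * p - u' * p') + K * d' * (u * p) := by
  have e : ψ' * p' - ψ * p = p' * (ψ' - ψ) - (p - p') * ψ := by ring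
  have h1 : |p' * (ψ' - ψ)| ≤ p' * (S * (u - u') + K * d * u) := by
    rw [abs_mul, abs_of_nonneg hp']; gcongr
  have h2 : |(p - p') * ψ| ≤ (p - p') * (S * u) := by
    rw [abs_mul, abs_of_nonneg (sub_nonneg.2 hpp)]
    exact mul_le_mul_of_nonneg_left hψ (sub_nonneg.2 hpp)
  have h3 : K * d * (u * p') ≤ K * d' * (u * p) := by
    have := hd0.trans hd
    gcongr
  rw [e]
  refine (abs_sub _ _).trans ?_
  linarith

lemma Dominated.transfer {a S K : ℝ} (ha : 0 < a) (hK : 0 ≤ K) {u ψ : ℝ → ℝ}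
    (hu : ∀ x ∈ Set.Ioc (0 : ℝ) 1, 0 ≤ u x) (h : Dominated S K u ψ) :
    Dominated S K (transfer a u) (transfer a ψ) where
  bound x hx := by
    have h1 := h.bound _ (leftInv_mem_unit ha hx)
    have h2 := h.bound _ (rightInv_mem_unit hx)
    have h3 := slope_pos ha (leftInv_mem_Ioc ha hx).1.le
    unfold PomeauManneville.transfer
    refine (abs_add_le _ _).trans ?_
    rw [abs_div, abs_div, abs_of_pos h3, abs_of_pos (two_pos (α := ℝ)), mul_add, ← mul_div_assoc,
      ← mul_div_assoc]
    gcongr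
  variation x hx y hy hxy := by
    have mx := leftInv_mem_unit ha hx
    have my := leftInv_mem_unit ha hy
    have hm := leftInv_mono ha hx hy hxy
    have s3 := slope_pos ha mx.1.le
    have s4 := slope_mono ha mx.1.le hm
    have h1 := abs_weighted_sub_le hK (hu _ mx) (inv_nonneg.2 (s3.trans_le s4).le)
      (inv_anti₀ s3 s4) (leftInv_sub_le ha hx hy hxy) (sub_nonneg.2 hm) (h.bound _ mx)
      (h.variation _ mx _ my hm)
    have h2 := abs_weighted_sub_le (p := 1 / 2) (p' := 1 / 2) hK (hu _ (rightInv_mem_unit hx))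
      (by norm_num) le_rfl (by linarith : (y + 1) / 2 - (x + 1) / 2 ≤ y - x) (by linarith)
      (h.bound _ (rightInv_mem_unit hx))
      (h.variation _ (rightInv_mem_unit hx) _ (rightInv_mem_unit hy) (by linarith))
    unfold PomeauManneville.transfer
    simp only [div_eq_mul_inv, one_mul] at h1 h2 ⊢
    rw [add_sub_add_comm]
    refine (abs_add_le _ _).trans ((add_le_add h1 h2).trans (le_of_eq ?_))
    ring

lemma Dominated.transferIter {β S K : ℝ} {α : ℕ → ℝ} (hα : Admissible β α) (hK : 0 ≤ K)
    {u ψ : ℝ → ℝ} (hu : ∀ x ∈ Set.Ioc (0 : ℝ) 1, 0 ≤ u x) (h : Dominated S K u ψ) (n : ℕ) :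
    Dominated S K (transferIter α n u) (transferIter α n ψ) := by
  induction n with
  | zero => exact h
  | succ n ih => exact ih.transfer (hα.pos n) hK (transferIter_nonneg hα hu n)

lemma Dominated.mul {S K s k : ℝ} {u ψ f : ℝ → ℝ}
    (hs : 0 ≤ s) (hk : 0 ≤ k) (hf : ∀ x ∈ Set.Ioc (0 : ℝ) 1, |f x| ≤ s)
    (hf' : ∀ x ∈ Set.Ioc (0 : ℝ) 1, ∀ y ∈ Set.Ioc (0 : ℝ) 1, x ≤ y → |f y - f x| ≤ k * (y - x))
    (h : Dominated S K u ψ) :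
    Dominated (s * S) (s * K + k * S) u (fun x => f x * ψ x) where
  bound x hx := by
    rw [abs_mul, mul_assoc]
    exact mul_le_mul (hf x hx) (h.bound x hx) (abs_nonneg _) hs
  variation x hx y hy hxy := by
    have e : f y * ψ y - f x * ψ x = f y * (ψ y - ψ x) + (f y - f x) * ψ x := by ring
    have h1 := mul_le_mul (hf y hy) (h.variation x hx y hy hxy) (abs_nonneg _) hs
    have h2 := mul_le_mul (hf' x hx y hy hxy) (h.bound x hx) (abs_nonneg _)
      (mul_nonneg hk (sub_nonneg.2 hxy))
    rw [e]
    refine (abs_add_le _ _).trans ?_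
    rw [abs_mul, abs_mul]
    linarith

/-- The slope `-K` of the added weight absorbs the Lipschitz part of the variation of `ψ`. -/
lemma Dominated.antitoneOn_add {S K : ℝ} (hK : 0 ≤ K) {u ψ : ℝ → ℝ}
    (hu : AntitoneOn u (Set.Ioc 0 1)) (h : Dominated S K u ψ) :
    AntitoneOn (fun x => ψ x + (S + K * (1 - x)) * u x) (Set.Ioc 0 1) := by
  intro x hx y hy hxy
  have h1 := (abs_le.1 (h.variation x hx y hy hxy)).2
  have h2 := hu hx hy hxy
  have h3 : 0 ≤ K * (1 - y) * (u x - u y) :=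
    mul_nonneg (mul_nonneg hK (sub_nonneg.2 hy.2)) (sub_nonneg.2 h2)
  dsimp only
  linarith

lemma antitoneOn_weight_mul {S K : ℝ} (hS : 0 ≤ S) (hK : 0 ≤ K) {u : ℝ → ℝ}
    (hu0 : ∀ x ∈ Set.Ioc (0 : ℝ) 1, 0 ≤ u x)
    (hu : AntitoneOn u (Set.Ioc 0 1)) :
    AntitoneOn (fun x => (S + K * (1 - x)) * u x) (Set.Ioc 0 1) := by
  intro x hx y hy hxy
  have h2 := hu hx hy hxy
  have h3 := hu0 y hy
  have h4 : 0 ≤ 1 - y := sub_nonneg.2 hy.2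
  dsimp only
  gcongr
  have : 0 ≤ 1 - x := sub_nonneg.2 hx.2
  positivity

lemma DecDensity.of_le_mul {β L : ℝ} {u g : ℝ → ℝ} (hL : 0 ≤ L) (hu : DecDensity β 1 u)
    (hi : Integrable g leb) (h0 : ∀ x ∈ Set.Ioc (0 : ℝ) 1, 0 ≤ g x)
    (hg : AntitoneOn g (Set.Ioc 0 1)) (hle : ∀ x ∈ Set.Ioc (0 : ℝ) 1, g x ≤ L * u x) :
    DecDensity β L g where
  integrable := hi
  nonneg := h0
  anti := hg
  le_rpow x hx := by
    refine (hle x hx).trans ?_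
    have := mul_le_mul_of_nonneg_left (hu.le_rpow x hx) hL
    linarith
  mass_le := by
    refine (integral_leb_mono hi (hu.integrable.const_mul L) hle).trans ?_
    rw [integral_const_mul]
    have := mul_le_mul_of_nonneg_left hu.mass_le hL
    linarith

/-- A function dominated by a decreasing density `u` minus the multiple of `u` with the same
integral is a difference of two decreasing densities of equal mass. -/
lemma Dominated.exists_eq_sub {β S K L : ℝ} (hS : 0 ≤ S) (hK : 0 ≤ K) (hL : S + K ≤ L)
    {u ψ : ℝ → ℝ} (hu : DecDensity β 1 u) (hu1 : ∫ x, u x ∂leb = 1) (hψ : Integrable ψ leb)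
    (h : Dominated S K u ψ) :
    ∃ g g' : ℝ → ℝ, DecDensity β (3 * L) g ∧ DecDensity β (3 * L) g' ∧
      ∫ x, g x ∂leb = ∫ x, g' x ∂leb ∧
      (fun x => g x - g' x) = fun x => ψ x - (∫ y, ψ y ∂leb) * u x := by
  set c := ∫ y, ψ y ∂leb with hc
  have hcS : |c| ≤ S := by
    refine (abs_integral_le_integral_abs).trans ?_
    refine (integral_leb_mono hψ.abs (hu.integrable.const_mul S) h.bound).trans ?_
    rw [integral_const_mul, hu1, mul_one]
  obtain ⟨hc1, hc2⟩ := abs_le.1 hcS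
  have hiw : Integrable (fun x => (S + K * (1 - x)) * u x) leb := by
    refine hu.integrable.bdd_mul (c := S + K) (by fun_prop) (ae_leb_Ioc.mono fun x hx => ?_)
    have : 0 ≤ 1 - x := sub_nonneg.2 hx.2
    rw [Real.norm_eq_abs, abs_of_nonneg (by positivity)]
    nlinarith [mul_nonneg hK hx.1.le]
  have hig : Integrable (fun x => (ψ x + (S + K * (1 - x)) * u x) + S * u x) leb :=
    (hψ.add hiw).add (hu.integrable.const_mul S)
  have hig' : Integrable (fun x => (S + K * (1 - x)) * u x + (c + S) * u x) leb :=
    hiw.add (hu.integrable.const_mul (c + S))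
  have hL0 : 0 ≤ 3 * L := by linarith
  have hsub : (fun x => ((ψ x + (S + K * (1 - x)) * u x) + S * u x) -
      ((S + K * (1 - x)) * u x + (c + S) * u x)) = fun x => ψ x - c * u x := by
    ext x; ring
  have hbound : ∀ x ∈ Set.Ioc (0 : ℝ) 1, 0 ≤ K * (1 - x) * u x ∧ K * (1 - x) * u x ≤ K * u x ∧
      (S + K) * u x ≤ L * u x ∧ 0 ≤ K * u x ∧ 0 ≤ S * u x := fun x hx => by
    have h0 := hu.nonneg x hx
    have h1 : 0 ≤ 1 - x := sub_nonneg.2 hx.2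
    refine ⟨by positivity, ?_, by gcongr, by positivity, by positivity⟩
    have : 0 ≤ K * u x * x := mul_nonneg (mul_nonneg hK h0) hx.1.le
    linarith
  refine ⟨_, _, DecDensity.of_le_mul hL0 hu hig (fun x hx => ?_) (fun x hx y hy hxy => ?_)
    (fun x hx => ?_), DecDensity.of_le_mul hL0 hu hig' (fun x hx => ?_)
    (fun x hx y hy hxy => ?_) (fun x hx => ?_), ?_, hsub⟩
  · obtain ⟨b1, b2, b3, b4, b5⟩ := hbound x hx
    have := (abs_le.1 (h.bound x hx)).1
    linarith
  · exact add_le_add (h.antitoneOn_add hK hu.anti hx hy hxy)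
      (mul_le_mul_of_nonneg_left (hu.anti hx hy hxy) hS)
  · obtain ⟨b1, b2, b3, b4, b5⟩ := hbound x hx
    have := (abs_le.1 (h.bound x hx)).2
    linarith
  · obtain ⟨b1, b2, b3, b4, b5⟩ := hbound x hx
    have := mul_nonneg (by linarith : 0 ≤ c + S) (hu.nonneg x hx)
    linarith
  · exact add_le_add (antitoneOn_weight_mul hS hK hu.nonneg hu.anti hx hy hxy)
      (mul_le_mul_of_nonneg_left (hu.anti hx hy hxy) (by linarith))
  · obtain ⟨b1, b2, b3, b4, b5⟩ := hbound x hx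
    have := mul_le_mul_of_nonneg_right hc2 (hu.nonneg x hx)
    linarith
  · rw [← sub_eq_zero, ← integral_sub hig hig', hsub,
      integral_sub hψ (hu.integrable.const_mul c), integral_const_mul, hu1, ← hc]
    ring

/-! ### Bounded observables and duality -/

lemma essNorm_nonneg (f : ℝ → ℝ) : 0 ≤ essNorm f := ENNReal.toReal_nonneg

lemma ae_abs_le_essNorm {f : ℝ → ℝ} (hf : MemLp f ⊤ leb) : ∀ᵐ x ∂leb, |f x| ≤ essNorm f := by
  filter_upwards [ae_le_eLpNormEssSup (f := f) (μ := leb)] with x hx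
  rw [← eLpNorm_exponent_top] at hx
  have := ENNReal.toReal_mono hf.2.ne hx
  simpa [essNorm] using this

lemma memLp_top_mul {f g : ℝ → ℝ} (hf : MemLp f ⊤ leb) (hg : MemLp g ⊤ leb) :
    MemLp (fun x => f x * g x) ⊤ leb := hg.mul' hf

lemma integrable_mul_of_memLp_top {f g : ℝ → ℝ} (hf : Integrable f leb) (hg : MemLp g ⊤ leb) :
    Integrable (fun x => f x * g x) leb := hf.mul_of_top_left hg

lemma memLp_top_comp {T g : ℝ → ℝ} (hT : Measure.QuasiMeasurePreserving T leb leb)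
    (hg : MemLp g ⊤ leb) : MemLp (fun x => g (T x)) ⊤ leb :=
  memLp_top_of_bound (hg.1.comp_quasiMeasurePreserving hT) _ (hT.ae (ae_abs_le_essNorm hg))

lemma quasiMeasurePreserving_compMap {β : ℝ} {α : ℕ → ℝ} (hα : Admissible β α) (n : ℕ) :
    Measure.QuasiMeasurePreserving (compMap α n) leb leb := by
  induction n with
  | zero => exact Measure.QuasiMeasurePreserving.id _
  | succ n ih => exact (quasiMeasurePreserving_pmMap (hα.pos n)).comp ih

lemma integral_transferIter_mul {β : ℝ} {α : ℕ → ℝ} (hα : Admissible β α) {f : ℝ → ℝ}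
    (hf : Integrable f leb) (n : ℕ) {g : ℝ → ℝ} (hg : MemLp g ⊤ leb) :
    ∫ x, transferIter α n f x * g x ∂leb = ∫ x, f x * g (compMap α n x) ∂leb := by
  induction n generalizing g with
  | zero => rfl
  | succ n ih =>
    have hg' := memLp_top_comp (quasiMeasurePreserving_pmMap (hα.pos n)) hg
    exact (integral_transfer_mul (hα.pos n)
      (integrable_mul_of_memLp_top (integrable_transferIter hα hf n) hg')).trans (ih hg')

/-! ### Lipschitz observables -/

lemma abs_le_supNorm {f : ℝ → ℝ} (hf : IsLip f) {x : ℝ} (hx : x ∈ Set.Icc (0 : ℝ) 1) :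
    |f x| ≤ supNorm f := by
  obtain ⟨K, hK⟩ := hf
  have hb : BddAbove (Set.range fun x : Set.Icc (0 : ℝ) 1 => |f x|) := by
    refine ⟨|f 0| + K, ?_⟩
    rintro _ ⟨y, rfl⟩
    have h := hK.dist_le_mul y y.2 0 (by norm_num)
    rw [Real.dist_eq, Real.dist_eq, sub_zero, abs_of_nonneg y.2.1] at h
    have h1 : (K : ℝ) * y ≤ K * 1 := mul_le_mul_of_nonneg_left y.2.2 K.2
    have h2 := abs_sub_abs_le_abs_sub (f y) (f 0)
    dsimp only
    linarith
  exact le_ciSup hb ⟨x, hx⟩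

lemma abs_sub_le_lipConst {f : ℝ → ℝ} (hf : IsLip f) {x y : ℝ} (hx : x ∈ Set.Icc (0 : ℝ) 1)
    (hy : y ∈ Set.Icc (0 : ℝ) 1) : |f x - f y| ≤ lipConst f * |x - y| := by
  rcases eq_or_ne x y with rfl | hxy
  · simp
  obtain ⟨K, hK⟩ := hf
  have hpos : 0 < |x - y| := abs_pos.2 (sub_ne_zero.2 hxy)
  rw [← div_le_iff₀ hpos]
  refine le_csSup ⟨K, ?_⟩ ⟨x, hx, y, hy, hxy, rfl⟩
  rintro _ ⟨x, hx, y, hy, hxy, rfl⟩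
  rw [div_le_iff₀ (abs_pos.2 (sub_ne_zero.2 hxy))]
  exact hK.dist_le_mul x hx y hy

lemma supNorm_nonneg (f : ℝ → ℝ) : 0 ≤ supNorm f := Real.iSup_nonneg fun _ => abs_nonneg _

lemma lipConst_nonneg (f : ℝ → ℝ) : 0 ≤ lipConst f := by
  refine Real.sSup_nonneg ?_
  rintro _ ⟨x, _, y, _, _, rfl⟩
  positivity

lemma lipNorm_nonneg (f : ℝ → ℝ) : 0 ≤ lipNorm f :=
  add_nonneg (supNorm_nonneg f) (lipConst_nonneg f)

lemma IsLip.memLp {f : ℝ → ℝ} (hf : IsLip f) : MemLp f ⊤ leb := by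
  refine memLp_top_of_bound ?_ (supNorm f)
    (ae_leb_Ioc.mono fun x hx => abs_le_supNorm hf (Set.Ioc_subset_Icc_self hx))
  obtain ⟨K, hK⟩ := hf
  exact hK.continuousOn.aestronglyMeasurable measurableSet_Icc

lemma Dominated.mul_isLip {S K : ℝ} {u ψ f : ℝ → ℝ} (hf : IsLip f) (h : Dominated S K u ψ) :
    Dominated (supNorm f * S) (supNorm f * K + lipConst f * S) u (fun x => f x * ψ x) := by
  refine h.mul (supNorm_nonneg f) (lipConst_nonneg f)
    (fun x hx => abs_le_supNorm hf (Set.Ioc_subset_Icc_self hx)) fun x hx y hy hxy => ?_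
  have := abs_sub_le_lipConst hf (Set.Ioc_subset_Icc_self hy) (Set.Ioc_subset_Icc_self hx)
  rwa [abs_of_nonneg (sub_nonneg.2 hxy)] at this

lemma dominated_self {u : ℝ → ℝ} (hu0 : ∀ x ∈ Set.Ioc (0 : ℝ) 1, 0 ≤ u x)
    (hu : AntitoneOn u (Set.Ioc 0 1)) : Dominated 1 0 u u where
  bound x hx := by rw [one_mul, abs_of_nonneg (hu0 x hx)]
  variation x hx y hy hxy := by
    rw [abs_sub_comm, abs_of_nonneg (sub_nonneg.2 (hu hx hy hxy))]; simp

/-- Submultiplicativity of the Lipschitz norm in terms of its two parts. -/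
lemma supNorm_mul_add_le {f : ℝ → ℝ} {S K L : ℝ} (hK : 0 ≤ K) (hL : S + K ≤ L) :
    supNorm f * S + (supNorm f * K + lipConst f * S) ≤ L * lipNorm f := by
  have h1 := mul_le_mul_of_nonneg_right hL (lipNorm_nonneg f)
  have h2 := mul_nonneg (lipConst_nonneg f) hK
  unfold lipNorm at *
  linarith

/-! ### Products of observables -/

lemma memLp_prodObs {β : ℝ} {α : ℕ → ℝ} (hα : Admissible β α) (n : ℕ → ℕ) (f : ℕ → ℝ → ℝ)
    (s : Finset ℕ) (hf : ∀ i ∈ s, MemLp (f i) ⊤ leb) : MemLp (prodObs α n f s) ⊤ leb := by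
  induction s using Finset.induction_on with
  | empty => exact (memLp_const 1).ae_eq (Filter.Eventually.of_forall fun x => by simp [prodObs])
  | insert i s hi ih =>
    have h := memLp_top_mul (memLp_top_comp (quasiMeasurePreserving_compMap hα (n i))
      (hf i (Finset.mem_insert_self i s))) (ih fun j hj => hf j (Finset.mem_insert_of_mem hj))
    exact h.ae_eq (Filter.Eventually.of_forall fun x => by
      simp only [prodObs, Finset.prod_insert hi])

/-- The observables of the past and the initial density are pushed forward to a single function
`ψ` at time `n l`. The constants `S` and `K` multiply like the two parts of the Lipschitz norm, so
that no constant accumulates with the number of factors. -/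
lemma exists_dominated_pushforward {β : ℝ} (hβ1 : β < 1) {α : ℕ → ℝ} (hα : Admissible β α)
    {h : ℝ → ℝ} (hh : DecDensity β 1 h) {n : ℕ → ℕ} (hn0 : n 0 = 0) {f : ℕ → ℝ → ℝ} (l : ℕ)
    (hn : ∀ i < l, n i ≤ n (i + 1)) (hf : ∀ i ≤ l, IsLip (f i)) :
    ∃ (ψ : ℝ → ℝ) (S K : ℝ), 0 ≤ S ∧ 0 ≤ K ∧
      S + K ≤ ∏ i ∈ Finset.range (l + 1), lipNorm (f i) ∧
      Integrable ψ leb ∧ Dominated S K (transferIter α (n l) h) ψ ∧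
      ∀ g : ℝ → ℝ, MemLp g ⊤ leb → ∫ x, ψ x * g x ∂leb =
        ∫ x, h x * (prodObs α n f (Finset.range (l + 1)) x * g (compMap α (n l) x)) ∂leb := by
  induction l with
  | zero =>
    have hf0 := hf 0 le_rfl
    refine ⟨fun x => f 0 x * h x, supNorm (f 0) * 1, supNorm (f 0) * 0 + lipConst (f 0) * 1,
      by have := supNorm_nonneg (f 0); positivity,
      by have := lipConst_nonneg (f 0); linarith, by simp [lipNorm], ?_, ?_, fun g _ => ?_⟩
    · simpa only [mul_comm] using integrable_mul_of_memLp_top hh.integrable hf0.memLp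
    · rw [hn0]; exact (dominated_self hh.nonneg hh.anti).mul_isLip hf0
    · refine integral_congr_ae (Filter.Eventually.of_forall fun x => ?_)
      simp only [prodObs, zero_add, Finset.prod_range_one, hn0, compMap, id]
      ring
  | succ l ih =>
    obtain ⟨ψ, S, K, hS, hK, hSK, hi, hD, hint⟩ := ih (fun i hi => hn i (by omega))
      (fun i hi => hf i (by omega))
    have hfl := hf (l + 1) le_rfl
    obtain ⟨m, hm⟩ := Nat.exists_eq_add_of_le (hn l (by omega))
    have hα' := hα.shift (n l)
    have hu := hh.transferIter hα hβ1 (n l)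
    have hi' := integrable_transferIter hα' hi m
    have hs := supNorm_nonneg (f (l + 1))
    have hk := lipConst_nonneg (f (l + 1))
    refine ⟨fun x => f (l + 1) x * transferIter (fun i => α (n l + i)) m ψ x,
      supNorm (f (l + 1)) * S, supNorm (f (l + 1)) * K + lipConst (f (l + 1)) * S,
      by positivity, by positivity, ?_, ?_, ?_, fun g hg => ?_⟩
    · rw [Finset.prod_range_succ]
      exact supNorm_mul_add_le hK hSK
    · simpa only [mul_comm] using integrable_mul_of_memLp_top hi' hfl.memLp
    · rw [hm, transferIter_add]
      exact (hD.transferIter hα' hK hu.nonneg m).mul_isLip hfl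
    · have hfg := memLp_top_mul hfl.memLp hg
      have e1 := integral_transferIter_mul hα' hi m hfg
      have e2 := hint _ (memLp_top_comp (quasiMeasurePreserving_compMap hα' m) hfg)
      calc ∫ x, f (l + 1) x * transferIter (fun i => α (n l + i)) m ψ x * g x ∂leb
          = ∫ x, transferIter (fun i => α (n l + i)) m ψ x * (f (l + 1) x * g x) ∂leb := by
            congr 1; ext x; ring
        _ = _ := e1.trans (e2.trans ?_)
      congr 1; ext x
      rw [hm, prodObs, prodObs, Finset.prod_range_succ _ (l + 1), hm, compMap_add,
        Function.comp_apply]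
      ring

/-- The observable in the future is a bounded function of the state at time `N`. -/
lemma exists_prodObs_eq_comp {β : ℝ} {α : ℕ → ℝ} (hα : Admissible β α) {n : ℕ → ℕ}
    {f : ℕ → ℝ → ℝ} (s : Finset ℕ) {N : ℕ} (hN : ∀ i ∈ s, N ≤ n i)
    (hf : ∀ i ∈ s, MemLp (f i) ⊤ leb) :
    ∃ g : ℝ → ℝ, MemLp g ⊤ leb ∧ (∀ᵐ x ∂leb, |g x| ≤ ∏ i ∈ s, essNorm (f i)) ∧
      ∀ x, prodObs α n f s x = g (compMap α N x) := by
  have hα' := hα.shift N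
  refine ⟨prodObs (fun i => α (N + i)) (fun i => n i - N) f s, memLp_prodObs hα' _ _ _ hf, ?_,
    fun x => Finset.prod_congr rfl fun i hi => ?_⟩
  · have h : ∀ᵐ x ∂leb, ∀ i ∈ s,
        |f i (compMap (fun i => α (N + i)) (n i - N) x)| ≤ essNorm (f i) :=
      (Filter.eventually_all_finset s).2 fun i hi =>
        (quasiMeasurePreserving_compMap hα' (n i - N)).ae (ae_abs_le_essNorm (hf i hi))
    filter_upwards [h] with x hx
    rw [prodObs, Finset.abs_prod]
    exact Finset.prod_le_prod (fun _ _ => abs_nonneg _) hx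
  · rw [← Function.comp_apply (f := compMap _ _), ← compMap_add, Nat.add_sub_cancel' (hN i hi)]

/-! ### Densities in the cone -/

lemma InCone.decDensity {β : ℝ} (hβ0 : 0 < β) (hβ1 : β < 1) {h : ℝ → ℝ} (hh : InCone β h)
    (h1 : ∫ x, h x ∂leb = 1) : DecDensity β 1 h where
  integrable := hh.integrable
  nonneg := hh.nonneg
  anti := hh.decreasing
  le_rpow x hx := by
    have e1 := hh.bound x hx
    rw [h1, mul_one] at e1
    have e2 : (2 : ℝ) ^ β ≤ 2 := by
      simpa using Real.rpow_le_rpow_of_exponent_le one_le_two hβ1.le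
    have e3 : (2 : ℝ) ^ β * (2 + β) ≤ coneConst β := by
      have := coneConst_ge hβ0 hβ1
      nlinarith
    have e4 := one_le_rpow_neg hβ0 hx
    rw [mul_one]
    exact e1.trans (mul_le_mul_of_nonneg_right e3 (by linarith))
  mass_le := h1.le

lemma toReal_ofReal_ae {h : ℝ → ℝ} (h0 : ∀ x ∈ Set.Ioc (0 : ℝ) 1, 0 ≤ h x) (F : ℝ → ℝ) :
    (fun x => (ENNReal.ofReal (h x)).toReal • F x) =ᵐ[leb] fun x => h x * F x := by
  filter_upwards [ae_leb_Ioc] with x hx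
  rw [ENNReal.toReal_ofReal (h0 x hx), smul_eq_mul]

lemma integral_density {h : ℝ → ℝ} (hi : Integrable h leb)
    (h0 : ∀ x ∈ Set.Ioc (0 : ℝ) 1, 0 ≤ h x) (F : ℝ → ℝ) :
    ∫ x, F x ∂(leb.withDensity fun x => ENNReal.ofReal (h x)) = ∫ x, h x * F x ∂leb := by
  rw [integral_withDensity_eq_integral_toReal_smul₀ hi.1.aemeasurable.ennreal_ofReal
    (Filter.Eventually.of_forall fun _ => ENNReal.ofReal_lt_top)]
  exact integral_congr_ae (toReal_ofReal_ae h0 F)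

lemma integrable_density {h : ℝ → ℝ} (hi : Integrable h leb)
    (h0 : ∀ x ∈ Set.Ioc (0 : ℝ) 1, 0 ≤ h x) {F : ℝ → ℝ} (hF : MemLp F ⊤ leb) :
    Integrable F (leb.withDensity fun x => ENNReal.ofReal (h x)) := by
  rw [integrable_withDensity_iff_integrable_smul₀' hi.1.aemeasurable.ennreal_ofReal
    (Filter.Eventually.of_forall fun _ => ENNReal.ofReal_lt_top)]
  exact (integrable_mul_of_memLp_top hi hF).congr (toReal_ofReal_ae h0 F).symm

end PomeauManneville

end

theorem corollary1p2 (β : ℝ) (hβ0 : 0 < β) (hβ1 : β < 1) :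
    ∃ C : ℝ, 0 < C ∧
      ∀ (α : ℕ → ℝ), PomeauManneville.Admissible β α →
      ∀ (l k : ℕ), l < k →
      ∀ (n : ℕ → ℕ), n 0 = 0 → (∀ i, i < k → n i ≤ n (i + 1)) →
      ∀ (f : ℕ → ℝ → ℝ),
        (∀ i, i ≤ l → PomeauManneville.IsLip (f i)) →
        (∀ i, l < i → i ≤ k → MemLp (f i) ⊤ PomeauManneville.leb) →
      ∀ (h : ℝ → ℝ), PomeauManneville.InCone β h →
      ∀ (μ : Measure ℝ), IsProbabilityMeasure μ →
        μ = PomeauManneville.leb.withDensity (fun x => ENNReal.ofReal (h x)) →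
      ∀ (H G : ℝ → ℝ),
        H = PomeauManneville.prodObs α n f (Finset.range (l + 1)) →
        G = PomeauManneville.prodObs α n f (Finset.Ioc l k) →
        Integrable (fun x => H x * G x) μ ∧ Integrable H μ ∧ Integrable G μ ∧
        |∫ x, H x * G x ∂μ - (∫ x, H x ∂μ) * ∫ x, G x ∂μ| ≤
          C * (∏ i ∈ Finset.range (l + 1), PomeauManneville.lipNorm (f i)) *
            (∏ i ∈ Finset.Ioc l k, PomeauManneville.essNorm (f i)) *
            PomeauManneville.rho β (n (l + 1) - n l) := by
  open PomeauManneville in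
  obtain ⟨C, hC, hmem⟩ := exists_memory_loss_rho hβ0 hβ1
  refine ⟨C * 3, by positivity, ?_⟩
  intro α hα l k hlk n hn0 hn f hfL hfE h hh μ hμ hμh H G hH hG
  have hHm : MemLp H ⊤ leb := by
    rw [hH]
    exact memLp_prodObs hα n f _ fun i hi =>
      (hfL i (Nat.lt_succ_iff.1 (Finset.mem_range.1 hi))).memLp
  have hfE' : ∀ i ∈ Finset.Ioc l k, MemLp (f i) ⊤ leb := fun i hi =>
    hfE i (Finset.mem_Ioc.1 hi).1 (Finset.mem_Ioc.1 hi).2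
  have hGm : MemLp G ⊤ leb := by
    rw [hG]; exact memLp_prodObs hα n f _ hfE'
  have hint : ∀ F : ℝ → ℝ, ∫ x, F x ∂μ = ∫ x, h x * F x ∂leb := fun F => by
    rw [hμh]; exact integral_density hh.integrable hh.nonneg F
  have hh1 : ∫ x, h x ∂leb = 1 := by
    have := hint fun _ => 1
    simpa using this.symm
  have hd := hh.decDensity hβ0 hβ1 hh1
  refine ⟨?_, ?_, ?_, ?_⟩
  · rw [hμh]; exact integrable_density hh.integrable hh.nonneg (memLp_top_mul hHm hGm)
  · rw [hμh]; exact integrable_density hh.integrable hh.nonneg hHm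
  · rw [hμh]; exact integrable_density hh.integrable hh.nonneg hGm
  obtain ⟨ψ, S, K, hS, hK, hSK, hψ, hD, hψint⟩ := exists_dominated_pushforward hβ1 hα hd hn0
    l (fun i hi => hn i (by omega)) hfL
  have hmono : ∀ i ∈ Finset.Ioc l k, n (l + 1) ≤ n i := by
    intro i hi
    obtain ⟨hi1, hi2⟩ := Finset.mem_Ioc.1 hi
    induction i, hi1 using Nat.le_induction with
    | base => exact le_rfl
    | succ j hj ih =>
      exact (ih (Finset.mem_Ioc.2 ⟨hj, by omega⟩) (by omega)).trans (hn j (by omega))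
  obtain ⟨g, hgm, hgb, hGg⟩ := exists_prodObs_eq_comp hα (Finset.Ioc l k) hmono hfE'
  obtain ⟨m, hm⟩ := Nat.exists_eq_add_of_le (hn l hlk)
  have hα' := hα.shift (n l)
  have hu := hd.transferIter hα hβ1 (n l)
  have hu1 : ∫ x, transferIter α (n l) h x ∂leb = 1 := by
    rw [integral_transferIter hα hd.integrable, hh1]
  set u := transferIter α (n l) h with hudef
  have hcomp : ∀ x, G x = g (compMap (fun i => α (n l + i)) m (compMap α (n l) x)) := fun x => by
    rw [hG, hGg, hm, compMap_add]; rfl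
  have hgm' := memLp_top_comp (quasiMeasurePreserving_compMap hα' m) hgm
  have hHG : ∫ x, H x * G x ∂μ =
      ∫ x, transferIter (fun i => α (n l + i)) m ψ x * g x ∂leb := by
    rw [hint, integral_transferIter_mul hα' hψ m hgm, hψint _ hgm']
    simp only [hcomp, hH]
  have hHψ : ∫ x, H x ∂μ = ∫ x, ψ x ∂leb := by
    have := hψint (fun _ => 1) (memLp_const 1)
    simp only [mul_one] at this
    rw [hint, this, hH]
  have hGu : ∫ x, G x ∂μ = ∫ x, transferIter (fun i => α (n l + i)) m u x * g x ∂leb := by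
    rw [hint, hudef, ← transferIter_add, ← hm, integral_transferIter_mul hα hd.integrable _ hgm]
    simp only [hG, hGg]
  obtain ⟨v, v', hv, hv', hvv, hsub⟩ := hD.exists_eq_sub hS hK hSK hu hu1 hψ
  have hloss := hmem _ hα' _ v v' hv hv' hvv m
  have hiu := integrable_transferIter hα' hu.integrable m
  have hiψ := integrable_transferIter hα' hψ m
  have hiv := integrable_transferIter hα' hv.integrable m
  have hiv' := integrable_transferIter hα' hv'.integrable m
  have hdiff : ∀ x, transferIter (fun i => α (n l + i)) m v x -
      transferIter (fun i => α (n l + i)) m v' x =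
      transferIter (fun i => α (n l + i)) m ψ x -
        (∫ y, ψ y ∂leb) * transferIter (fun i => α (n l + i)) m u x := by
    have e1 := transferIter_sub (fun i => α (n l + i)) m v v'
    have e2 := transferIter_add_mul (fun i => α (n l + i)) m ψ u (-∫ y, ψ y ∂leb)
    simp only [neg_mul, ← sub_eq_add_neg] at e2
    rw [hsub, e2] at e1
    exact fun x => (congrFun e1 x).symm
  have hkey : ∫ x, H x * G x ∂μ - (∫ x, H x ∂μ) * ∫ x, G x ∂μ =
      ∫ x, (transferIter (fun i => α (n l + i)) m v x -
        transferIter (fun i => α (n l + i)) m v' x) * g x ∂leb := by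
    rw [hHG, hHψ, hGu, ← integral_const_mul, ← integral_sub
      (integrable_mul_of_memLp_top hiψ hgm) ((integrable_mul_of_memLp_top hiu hgm).const_mul _)]
    congr 1; ext x
    rw [hdiff]; ring
  have hE : 0 ≤ ∏ i ∈ Finset.Ioc l k, essNorm (f i) :=
    Finset.prod_nonneg fun i _ => essNorm_nonneg _
  rw [hkey, hm, Nat.add_sub_cancel_left]
  calc |∫ x, (transferIter (fun i => α (n l + i)) m v x -
        transferIter (fun i => α (n l + i)) m v' x) * g x ∂leb|
      ≤ ∫ x, |(transferIter (fun i => α (n l + i)) m v x -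
        transferIter (fun i => α (n l + i)) m v' x) * g x| ∂leb := abs_integral_le_integral_abs
    _ ≤ ∫ x, |transferIter (fun i => α (n l + i)) m v x -
        transferIter (fun i => α (n l + i)) m v' x| *
          ∏ i ∈ Finset.Ioc l k, essNorm (f i) ∂leb := by
        refine integral_mono_ae (integrable_mul_of_memLp_top (hiv.sub hiv') hgm).abs
          ((hiv.sub hiv').abs.mul_const _) ?_
        filter_upwards [hgb] with x hx
        rw [abs_mul]
        exact mul_le_mul_of_nonneg_left hx (abs_nonneg _)
    _ = (∫ x, |transferIter (fun i => α (n l + i)) m v x -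
        transferIter (fun i => α (n l + i)) m v' x| ∂leb) *
          ∏ i ∈ Finset.Ioc l k, essNorm (f i) := integral_mul_const _ _
    _ ≤ (C * (3 * ∏ i ∈ Finset.range (l + 1), lipNorm (f i)) * rho β m) *
          ∏ i ∈ Finset.Ioc l k, essNorm (f i) := mul_le_mul_of_nonneg_right hloss hE
    _ = _ := by ring
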